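/- Let $M$ be a connected, oriented smooth surface, possibly with non-empty boundary, and let $g_1, g_2$ be two smooth Riemannian metrics on $M$. For $k=1,2$ let $SM_k=\{(x,v)\in TM : g_k(v,v)=1\}$ be the unit tangent bundle, with its canonical contact form $(\boldsymbol\alpha_k)_{(x,v)}(\xi)=g_k(d\pi(\xi),v)$, where $\pi\colon TM\to M$ is the projection, and let $Z_{g_k}=\{(x,v)\in TM : g_k(v,v)\le 1\}$ be the transport twistor space. It carries the complex $2$-plane bundle $\mathscr D_k\subset T_{\mathbb C}Z_{g_k}$ which at $(x,v)$ is described as follows: for a positively oriented $g_k$-orthonormal basis $(e_0,e_1)$ of $T_xM$ put $\partial_{\bar z}=\frac12(e_0+ie_1)$, $\partial_z=\frac12(e_0-ie_1)$ and $v=(\operatorname{Re}\mu)e_0+(\operatorname{Im}\mu)e_1$ with $\mu\in\mathbb C$; then $\mathscr D_k$ is spanned by the vertical lift of $\partial_{\bar z}$ and the horizontal lift (for the Levi-Civita connection of $g_k$) of $\partial_{\bar z}+\mu^2\partial_z$. A biholomorphism $\Phi\colon Z_{g_1}\to Z_{g_2}$ is a diffeomorphism, smooth up to the boundary, such that $\Phi$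 and $\Phi^{-1}$ are holomorphic, that is, $d\Phi(\mathscr D_1)\subset\mathscr D_2$ and $d\Phi^{-1}(\mathscr D_2)\subset\mathscr D_1$. Let $\phi\colon SM_1\to SM_2$ be a diffeomorphism such that $\phi^*\boldsymbol\alpha_2=\boldsymbol\alpha_1$. Then $\phi$ extends to a biholomorphism $Z_{g_1}\to Z_{g_2}$ if and only if it is the lift of an orientation preserving isometry $\varphi\colon (M,g_1)\to(M,g_2)$, that is, $\phi(x,v)=(\varphi(x),d\varphi_x(v))$ for all $(x,v)\in SM_1$. -/

import Mathlib

open Set Bundle Manifold Topology TensorProduct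
open scoped ContDiff

noncomputable section

namespace TransportTwistor

/-- The model vector space `ℝ²` of a surface. -/
abbrev Plane : Type := EuclideanSpace ℝ (Fin 2)

/-- Surfaces, with possibly empty boundary, are modelled on the closed half-plane. -/
abbrev HalfPlane : Type := EuclideanHalfSpace 2

variable {M : Type*} [TopologicalSpace M] [ChartedSpace HalfPlane M] [IsManifold (𝓡∂ 2) ∞ M]

/-- The tangent space `T_x M`. -/
abbrev TangentAt (x : M) : Type := TangentSpace (𝓡∂ 2) x

variable (M) in
/-- The total space of the tangent bundle, itself a smooth manifold modelled with corners on
`(𝓡∂ 2).tangent`. -/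
abbrev TM : Type _ := TangentBundle (𝓡∂ 2) M

/-- The tangent space `T_p (TM)` of the tangent bundle at `p = (x, v)`. In Mathlib this is
`ℝ² × ℝ²`: the coordinates of a tangent vector in the chart `(x, v) ↦ (xⁱ, vⁱ)` of `TM` induced
by the preferred chart of `M` at the foot point of `p`. In the same way `T_x M` is `ℝ²`, the
coordinates being those of the preferred chart of `M` at `x`. -/
abbrev TangentTM (p : TM M) : Type := TangentSpace (𝓡∂ 2).tangent p

variable (M) in
/-- A smooth Riemannian metric on the surface `M` (smooth up to the boundary). -/
abbrev Metric : Type _ :=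
  ContMDiffRiemannianMetric (𝓡∂ 2) ∞ Plane (fun x : M => TangentSpace (𝓡∂ 2) x)

variable (M) in
/-- An orientation of the surface `M`: an orientation of every tangent space which is locally
constant in the local trivialisations of the tangent bundle given by the charts. -/
structure SurfaceOrientation where
  /-- the orientation of `T_x M` -/
  orient : ∀ x : M, Orientation ℝ (TangentAt x) (Fin 2)
  /-- local constancy -/
  locally_constant : ∀ x₀ : M, ∃ o : Orientation ℝ Plane (Fin 2), ∀ᶠ x in 𝓝 x₀,
    ∀ hx : x ∈ (trivializationAt Plane (fun x : M => TangentSpace (𝓡∂ 2) x) x₀).baseSet,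
      Orientation.map (Fin 2)
        ((trivializationAt Plane (fun x : M => TangentSpace (𝓡∂ 2) x) x₀).continuousLinearEquivAt
          ℝ x hx).toLinearEquiv (orient x) = o

/-! ### Unit tangent bundle, unit disk bundle, contact form -/

/-- The function `(x, v) ↦ g_x(v, v)` on `TM`. -/
def normSq (g : Metric M) (p : TM M) : ℝ := g.inner p.proj p.snd p.snd

/-- The unit tangent bundle `SM`, as a subset of `TM`. -/
def unitTangent (g : Metric M) : Set (TM M) := {p | normSq g p = 1}

/-- The closed unit disk bundle `Z`, as a subset of `TM`. -/
def diskBundle (g : Metric M) : Set (TM M) := {p | normSq g p ≤ 1}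

/-- The tangent space `T_p (SM)` as a subspace of `T_p (TM)`, for `p ∈ SM`: the kernel of the
differential of `(x, v) ↦ g_x(v, v)`. -/
def tangentUnit (g : Metric M) (p : TM M) : Submodule ℝ (TangentTM p) :=
  LinearMap.ker (mfderiv (𝓡∂ 2).tangent 𝓘(ℝ, ℝ) (normSq g) p).toLinearMap

/-- The canonical 1-form `α_{(x, v)}(ξ) = g_x(dπ ξ, v)`, `π : TM → M` being the projection. On
the tangent spaces of `SM` this is the canonical contact form. -/
def contactForm (g : Metric M) (p : TM M) (ξ : TangentTM p) : ℝ :=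
  g.inner p.proj (mfderiv (𝓡∂ 2).tangent (𝓡∂ 2) (fun q : TM M => q.proj) p ξ) p.snd

/-- `Φ` restricts to a diffeomorphism from `s` onto `t` with inverse `Ψ`. Here `s` and `t` are
subsets of `TM` such as `SM` (an embedded submanifold) or `Z` (a domain with corners), and
`ContMDiffOn` expresses smoothness for their induced smooth structure, up to the boundary. Only
the values of `Φ` on `s` and of `Ψ` on `t` matter. -/
structure IsDiffeoPair (s t : Set (TM M)) (Φ Ψ : TM M → TM M) : Prop where
  mapsTo : MapsTo Φ s t
  mapsTo_inv : MapsTo Ψ t s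
  invOn : InvOn Ψ Φ s t
  smooth : ContMDiffOn (𝓡∂ 2).tangent (𝓡∂ 2).tangent ∞ Φ s
  smooth_inv : ContMDiffOn (𝓡∂ 2).tangent (𝓡∂ 2).tangent ∞ Ψ t

/-- `Φ` restricts to a diffeomorphism from `s` onto `t`. -/
def IsDiffeoOn (Φ : TM M → TM M) (s t : Set (TM M)) : Prop :=
  ∃ Ψ : TM M → TM M, IsDiffeoPair s t Φ Ψ

/-- `φ^* α₂ = α₁` on `SM₁`. The derivative of `φ` within `SM₁` is determined on the tangent
spaces of `SM₁`, which is where it is used. -/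
def PullsBackContactForm (g₁ g₂ : Metric M) (φ : TM M → TM M) : Prop :=
  ∀ p ∈ unitTangent g₁, ∀ ξ ∈ tangentUnit g₁ p,
    contactForm g₂ (φ p)
      (mfderivWithin (𝓡∂ 2).tangent (𝓡∂ 2).tangent φ (unitTangent g₁) p ξ) = contactForm g₁ p ξ

/-! ### Horizontal and vertical lifts -/

/-- The metric as a bilinear form on `T_x M`. -/
def metricForm (g : Metric M) (x : M) : LinearMap.BilinForm ℝ (TangentAt x) :=
  LinearMap.mk₂ ℝ (fun u w => g.inner x u w) (by intros; simp) (by intros; simp)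
    (by intros; simp) (by intros; simp)

theorem metricForm_nondegenerate (g : Metric M) (x : M) : (metricForm g x).Nondegenerate := by
  have h : ∀ u : TangentAt x, g.inner x u u = 0 → u = 0 := fun u hu => by
    by_contra hne
    exact (g.pos x u hne).ne' hu
  exact ⟨fun u hu => h u (hu u), fun u hu => h u (hu u)⟩

instance (x : M) : FiniteDimensional ℝ (TangentAt x) :=
  inferInstanceAs (FiniteDimensional ℝ Plane)

/-- The coordinate expression of the metric in the preferred chart at `x₀`: the bilinear form
`(g_{ij}(y))` on `ℝ²`, for `y` in the range of the chart. -/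
def chartMetric (g : Metric M) (x₀ : M) (y : Plane) : Plane →L[ℝ] Plane →L[ℝ] ℝ :=
  let q : M := (extChartAt (𝓡∂ 2) x₀).symm y
  let A : Plane →L[ℝ] TangentAt q :=
    (trivializationAt Plane (fun x : M => TangentSpace (𝓡∂ 2) x) x₀).symmL ℝ q
  (ContinuousLinearMap.precomp ℝ A).comp ((g.inner q).comp A)

set_option synthInstance.maxHeartbeats 200000 in
/-- The first derivatives `∂_k g_{ij}` of the metric at `x`, in the preferred chart at `x`; the
direction of differentiation is the first argument. -/
def chartMetricDeriv (g : Metric M) (x : M) :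
    Plane →L[ℝ] Plane →L[ℝ] Plane →L[ℝ] ℝ :=
  fderivWithin ℝ (chartMetric g x) (range (𝓡∂ 2)) (extChartAt (𝓡∂ 2) x x)

set_option synthInstance.maxHeartbeats 200000 in
/-- The Christoffel symbols of the first kind at `x`, in the preferred chart at `x`:
`½ (∂_a g(b, c) + ∂_b g(a, c) - ∂_c g(a, b))`. -/
def christoffelFirst (g : Metric M) (x : M) (b : Plane) : Plane →ₗ[ℝ] Module.Dual ℝ Plane :=
  LinearMap.mk₂ ℝ
    (fun a c : Plane => (1 / 2 : ℝ) * (chartMetricDeriv g x a b c + chartMetricDeriv g x b a c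
      - chartMetricDeriv g x c a b))
    (by intros; simp; ring) (by intros; simp; ring) (by intros; simp; ring)
    (by intros; simp; ring)

/-- The Christoffel symbols `Γ(a, b)` of the Levi-Civita connection of `g` at `x`, in the
preferred chart at `x`, as a linear map of `a`: `g(Γ(a, b), c)` is the Christoffel symbol of the
first kind. -/
def christoffel (g : Metric M) (x : M) (b : TangentAt x) : TangentAt x →ₗ[ℝ] TangentAt x :=
  ((metricForm g x).toDual (metricForm_nondegenerate g x)).symm.toLinearMap ∘ₗ
    christoffelFirst g x b

/-- The horizontal lift `T_x M → T_{(x, v)} TM` for the Levi-Civita connection: in the coordinates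
`(xⁱ, vⁱ)` it is `u ↦ (u, -Γ(u, v))`. -/
def horizontalLift (g : Metric M) (p : TM M) : TangentAt p.proj →ₗ[ℝ] TangentTM p :=
  LinearMap.prod (M₂ := Plane) (M₃ := Plane) LinearMap.id (-(christoffel g p.proj p.snd))

/-- The vertical lift `T_x M → T_{(x, v)} TM`: the derivative of the inclusion of the fibre
`T_x M` into `TM`, in the coordinates `(xⁱ, vⁱ)` given by `w ↦ (0, w)`. -/
def verticalLift (p : TM M) : TangentAt p.proj →ₗ[ℝ] TangentTM p :=
  LinearMap.inr ℝ Plane Plane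

/-! ### The involutive structure of transport twistor space -/

/-- A positively oriented `g`-orthonormal basis of `T_x M`. -/
def IsOrientedOrthonormal (o : SurfaceOrientation M) (g : Metric M) (x : M)
    (e : Module.Basis (Fin 2) ℝ (TangentAt x)) : Prop :=
  e.orientation = o.orient x ∧ g.inner x (e 0) (e 0) = 1 ∧ g.inner x (e 1) (e 1) = 1 ∧
    g.inner x (e 0) (e 1) = 0

/-- `T^{0,1}_x M ⊆ ℂ ⊗ T_x M` for the complex structure defined by the metric and the
orientation (rotation by `π/2`): it is spanned by `e₀ + i e₁` for `(e₀, e₁)` a positively oriented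
orthonormal basis. -/
def antiholomorphicTangent (o : SurfaceOrientation M) (g : Metric M) (x : M) :
    Submodule ℂ (ℂ ⊗[ℝ] TangentAt x) :=
  Submodule.span ℂ {ζ | ∃ e : Module.Basis (Fin 2) ℝ (TangentAt x),
    IsOrientedOrthonormal o g x e ∧ ζ = (1 : ℂ) ⊗ₜ[ℝ] e 0 + Complex.I ⊗ₜ[ℝ] e 1}

/-- The real endomorphism `u ↦ u + v² ū = u + (2 g(u, v) v - g(v, v) u)` of `T_x M` at the point
`p = (x, v)`, the products being those of `T_x M ≅ ℂ`. If `v = μ · e₀` with `(e₀, e₁)` a positively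
oriented orthonormal basis, and `∂_z̄ = ½ (e₀ + i e₁)`, `∂_z = ½ (e₀ - i e₁)`, then its complex
linear extension maps `∂_z̄` to `∂_z̄ + μ² ∂_z`. -/
def twist (g : Metric M) (p : TM M) : TangentAt p.proj →ₗ[ℝ] TangentAt p.proj :=
  (1 - normSq g p) • LinearMap.id +
    (2 : ℝ) • (metricForm g p.proj p.snd).smulRight (p.snd : TangentAt p.proj)

/-- The complex 2-plane bundle `𝒟` of transport twistor space: at `p = (x, v)` it is spanned by
the vertical lift of `∂_z̄`, that is the `(0,1)`-vectors of the fibre, and by the horizontal lift of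
`∂_z̄ + μ² ∂_z`, where `v = μ · e₀`. -/
def twistorStructure (o : SurfaceOrientation M) (g : Metric M) (p : TM M) :
    Submodule ℂ (ℂ ⊗[ℝ] TangentTM p) :=
  (antiholomorphicTangent o g p.proj).map ((verticalLift p).baseChange ℂ) ⊔
    (antiholomorphicTangent o g p.proj).map ((horizontalLift g p ∘ₗ twist g p).baseChange ℂ)

/-- The map `Φ : Z₁ → Z₂` between transport twistor spaces is holomorphic:
`dΦ (𝒟₁) ⊆ 𝒟₂` at every point of `Z₁`, where `dΦ` is extended complex linearly. -/
def IsHolomorphicOn (o : SurfaceOrientation M) (g₁ g₂ : Metric M) (Φ : TM M → TM M) : Prop :=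
  ∀ p ∈ diskBundle g₁, (twistorStructure o g₁ p).map
    ((mfderivWithin (𝓡∂ 2).tangent (𝓡∂ 2).tangent Φ (diskBundle g₁) p).toLinearMap.baseChange ℂ)
      ≤ twistorStructure o g₂ (Φ p)

/-- `Φ` restricts to a biholomorphism `Z₁ → Z₂` of transport twistor spaces: a diffeomorphism
(up to the boundary) which is holomorphic, as is its inverse. -/
def IsBiholomorphism (o : SurfaceOrientation M) (g₁ g₂ : Metric M) (Φ : TM M → TM M) : Prop :=
  ∃ Ψ : TM M → TM M, IsDiffeoPair (diskBundle g₁) (diskBundle g₂) Φ Ψ ∧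
    IsHolomorphicOn o g₁ g₂ Φ ∧ IsHolomorphicOn o g₂ g₁ Ψ

/-! ### Isometries -/

/-- The diffeomorphism `f : (M, g₁) → (M, g₂)` is an orientation preserving isometry. -/
def IsOrientedIsometry (o : SurfaceOrientation M) (g₁ g₂ : Metric M)
    (f : M ≃ₘ^∞⟮𝓡∂ 2, 𝓡∂ 2⟯ M) : Prop :=
  (∀ (x : M) (u w : TangentAt x),
    g₂.inner (f x) (mfderiv (𝓡∂ 2) (𝓡∂ 2) f x u) (mfderiv (𝓡∂ 2) (𝓡∂ 2) f x w)
      = g₁.inner x u w) ∧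
  ∀ x : M, Orientation.map (Fin 2)
    (f.mfderivToContinuousLinearEquiv (by simp) x).toLinearEquiv (o.orient x) = o.orient (f x)

end TransportTwistor

end

/-! Suppose `Φ` is a biholomorphism extending `φ`. At a unit vector `v`, complete `e 0 = v` to a
positively oriented orthonormal basis. The complex tangent vector with real part the radial vertical
lift of `e 0` and imaginary part the vertical lift of `e 1`, tangent to the fibre circle, lies in
the involutive structure. Over unit vectors this structure is spanned by that vertical vector and by
the geodesic vector, the horizontal lift of `v`, which is real
(`exists_coeff_of_mem_twistorStructure`). So the image under `dΦ` is `b` times the corresponding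
vertical vector at `Φ p` plus `a` times the geodesic vector there.

Three conditions at the boundary pin down the imaginary part (`isPositiveVertical_of_map_le`). Unit
vectors go to unit vectors, so `Im b = 0`. The contact form vanishes on vertical vectors and is
pulled back, so `Im a = 0`. The squared norm of `Φ` is largest on the boundary, so its outward
derivative `2 Re b` is non-negative. Hence `dΦ` sends the positive direction of each fibre circle to
a non-negative multiple of the positive direction of another, and `Φ` covers a smooth map `f` of the
base (`exists_base_map`).

The contact condition then reads `g₂(df u, Φ v) = g₁(u, v)` (`inner_mfderiv_base_map`): the adjoint
of `df` takes `Φ v` to `v`. As `Φ` is onto the unit circle, this adjoint preserves unit length,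
which forces `Φ v = df v` (`mfderiv_eq_of_inner`) and makes `f` an isometry. The sign of `Re b` says
that `f` preserves the orientation.

Conversely, the tangent map of an oriented isometry commutes with vertical lifts, with `twist`, with
(0,1)-vectors and with Levi-Civita horizontal lifts. The last fact is the transformation law of
Christoffel symbols (`PreservesMetric.mfderiv_christoffel`). At boundary points derivatives within
the disk bundle are still unique (`eq_of_hasMFDerivWithinAt_diskBundle`), so the usual derivative of
the tangent map decides holomorphy. -/

noncomputable section

namespace TransportTwistor

/-! ### Coordinates on the tangent bundle and velocities of curves -/

section TangentBundleCharts

variable {E H : Type*} [NormedAddCommGroup E] [NormedSpace ℝ E] [TopologicalSpace H]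
  {I : ModelWithCorners ℝ E H} {N : Type*} [TopologicalSpace N] [ChartedSpace H N]
  [IsManifold I 1 N]
  {E' H' : Type*} [NormedAddCommGroup E'] [NormedSpace ℝ E'] [TopologicalSpace H']
  {J : ModelWithCorners ℝ E' H'} {S : Type*} [TopologicalSpace S] [ChartedSpace H' S]

theorem trivializationAt_snd_self (p : TangentBundle I N) :
    (trivializationAt E (TangentSpace I) p.proj p).2 = p.snd :=
  (tangentBundleCore I N).coordChange_self (achart H p.proj) p.proj (mem_achart_source H p.proj)
    p.snd

theorem trivializationAt_snd_self_mk (x : N) (v : TangentSpace I x) :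
    (trivializationAt E (TangentSpace I) x (⟨x, v⟩ : TangentBundle I N)).2 = v :=
  trivializationAt_snd_self ⟨x, v⟩

/-- The derivative of the projection of the tangent bundle, in the coordinates of `TangentTM`. -/
def projDeriv (p : TangentBundle I N) : TangentSpace I.tangent p →L[ℝ] TangentSpace I p.proj :=
  ContinuousLinearMap.fst ℝ E E

/-- The tangent vector of the tangent bundle with given coordinates. -/
def liftVec (p : TangentBundle I N) (u w : TangentSpace I p.proj) : TangentSpace I.tangent p :=
  ((u, w) : E × E)

@[simp]
theorem projDeriv_liftVec (p : TangentBundle I N) (u w : TangentSpace I p.proj) :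
    projDeriv p (liftVec p u w) = u := rfl

theorem liftVec_add (p : TangentBundle I N) (u w u' w' : TangentSpace I p.proj) :
    liftVec p (u + u') (w + w') = liftVec p u w + liftVec p u' w' := rfl

theorem liftVec_smul (p : TangentBundle I N) (c : ℝ) (u w : TangentSpace I p.proj) :
    liftVec p (c • u) (c • w) = c • liftVec p u w := rfl

theorem exists_eq_liftVec (p : TangentBundle I N) (ξ : TangentSpace I.tangent p) :
    ∃ w, ξ = liftVec p (projDeriv p ξ) w := ⟨Prod.snd (α := E) (β := E) ξ, rfl⟩

/-- The chart of the tangent bundle at `p` covers the chart of `N` at the foot point, so in these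
charts the projection is `Prod.fst`. -/
theorem hasMFDerivWithinAt_proj_tangentBundle (p : TangentBundle I N) (s : Set (TangentBundle I N)) :
    HasMFDerivWithinAt I.tangent I (fun q : TangentBundle I N => q.proj) s p (projDeriv p) := by
  refine ⟨(FiberBundle.continuous_proj E (TangentSpace I)).continuousWithinAt, ?_⟩
  refine (hasFDerivWithinAt_fst (𝕜 := ℝ) (E := E) (F := E)).congr_of_eventuallyEq ?_ ?_
  · have h : (extChartAt I.tangent p).target ∈ 𝓝[range I.tangent] (extChartAt I.tangent p p) :=
      extChartAt_target_mem_nhdsWithin p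
    filter_upwards [nhdsWithin_mono _ inter_subset_right h] with z hz
    have h1 : z.1 ∈ (extChartAt I p.proj).target := by
      have := hz
      rw [ModelWithCorners.tangent, FiberBundle.extChartAt_target] at this
      exact this.1.1
    have h2 : ((extChartAt I.tangent p).symm z).proj = (extChartAt I p.proj).symm z.1 := rfl
    change extChartAt I p.proj ((extChartAt I.tangent p).symm z).proj = z.1
    rw [h2, (extChartAt I p.proj).right_inv h1]
  · change extChartAt I p.proj ((extChartAt I.tangent p).symm (extChartAt I.tangent p p)).proj = _
    rw [extChartAt_to_inv]
    rfl

theorem hasMFDerivAt_proj_tangentBundle (p : TangentBundle I N) :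
    HasMFDerivAt I.tangent I (fun q : TangentBundle I N => q.proj) p (projDeriv p) := by
  rw [← hasMFDerivWithinAt_univ]
  exact hasMFDerivWithinAt_proj_tangentBundle p univ

/-- The linear map into the tangent space of the tangent bundle with given components. -/
def liftMap {y : S} (p : TangentBundle I N) (A B : TangentSpace J y →L[ℝ] TangentSpace I p.proj) :
    TangentSpace J y →L[ℝ] TangentSpace I.tangent p :=
  ContinuousLinearMap.prod (M₂ := E) (M₃ := E) A B

theorem liftMap_apply {y : S} (p : TangentBundle I N)
    (A B : TangentSpace J y →L[ℝ] TangentSpace I p.proj) (u : TangentSpace J y) :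
    liftMap p A B u = liftVec p (A u) (B u) := rfl

/-- The chart of the tangent bundle at `h y` pairs the base chart with the trivialisation frozen at
the foot point of `h y`, so the two components can be differentiated separately. -/
theorem HasMFDerivWithinAt.tangentBundle_mk {h : S → TangentBundle I N} {s : Set S} {y : S}
    (hc : ContinuousWithinAt h s y)
    {A B : TangentSpace J y →L[ℝ] TangentSpace I (h y).proj}
    (h₁ : HasMFDerivWithinAt J I (fun z => (h z).proj) s y A)
    (h₂ : HasMFDerivWithinAt J 𝓘(ℝ, E)
      (fun z => (trivializationAt E (TangentSpace I) (h y).proj (h z)).2) s y B) :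
    HasMFDerivWithinAt J I.tangent h s y (liftMap (h y) A B) := by
  refine ⟨hc, ?_⟩
  exact HasFDerivWithinAt.prodMk (𝕜 := ℝ) (E := E') (F := E) (G := E) h₁.2 h₂.2

/-- The unit tangent vector of the real line. -/
def unitVec (t : ℝ) : TangentSpace 𝓘(ℝ, ℝ) t := (1 : ℝ)

/-- The linear map `ℝ → T_x N` with value `ξ` at `1`. -/
def velocityMap {t : ℝ} {x : N} (ξ : TangentSpace I x) :
    TangentSpace 𝓘(ℝ, ℝ) t →L[ℝ] TangentSpace I x :=
  ContinuousLinearMap.toSpanSingleton ℝ (M₁ := E) ξ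

omit [IsManifold I 1 N] in
theorem velocityMap_unitVec {t : ℝ} {x : N} (ξ : TangentSpace I x) :
    velocityMap ξ (unitVec t) = ξ := @one_smul ℝ E _ _ ξ

omit [IsManifold I 1 N] in
theorem eq_velocityMap {t : ℝ} {x : N} (A : TangentSpace 𝓘(ℝ, ℝ) t →L[ℝ] TangentSpace I x) :
    A = velocityMap (A (unitVec t)) := by
  refine ContinuousLinearMap.ext fun r => ?_
  obtain ⟨a, rfl⟩ : ∃ a : ℝ, r = a • unitVec t := ⟨r, (mul_one (M := ℝ) r).symm⟩
  rw [map_smul, map_smul, velocityMap_unitVec]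

/-- `ξ` is the velocity of the curve `c` at time `t`, within the set of times `s`. -/
def HasVelocityWithinAt (I : ModelWithCorners ℝ E H) (c : ℝ → N) (s : Set ℝ) (t : ℝ)
    (ξ : TangentSpace I (c t)) : Prop :=
  HasMFDerivWithinAt 𝓘(ℝ, ℝ) I c s t (velocityMap ξ)

omit [IsManifold I 1 N] in
theorem HasVelocityWithinAt.comp {c : ℝ → N} {s : Set ℝ} {t : ℝ} {ξ : TangentSpace I (c t)}
    (hc : HasVelocityWithinAt I c s t ξ) {f : N → S} {u : Set N}
    {f' : TangentSpace I (c t) →L[ℝ] TangentSpace J (f (c t))}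
    (hf : HasMFDerivWithinAt I J f u (c t) f') (hu : MapsTo c s u) :
    HasVelocityWithinAt J (fun t => f (c t)) s t (f' ξ) := by
  have h := HasMFDerivWithinAt.comp t hf hc hu
  rw [eq_velocityMap (f'.comp (velocityMap ξ))] at h
  have h1 : (f'.comp (velocityMap ξ)) (unitVec t) = f' ξ :=
    congrArg f' (velocityMap_unitVec (t := t) ξ)
  rw [h1] at h
  exact h

-- Unique differentiability is needed only for the set of times. Derivatives within the unit tangent
-- bundle or the disk bundle are therefore compared by testing them on curves.
omit [IsManifold I 1 N] in
theorem HasVelocityWithinAt.unique {c : ℝ → N} {s : Set ℝ} {t : ℝ} {ξ η : TangentSpace I (c t)}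
    (hc : HasVelocityWithinAt I c s t ξ) (hc' : HasVelocityWithinAt I c s t η)
    (hs : UniqueDiffWithinAt ℝ s t) : ξ = η := by
  have h := hs.uniqueMDiffWithinAt.eq hc hc'
  rw [← velocityMap_unitVec (t := t) ξ, h, velocityMap_unitVec]

theorem hasVelocityWithinAt_vectorSpace {c : ℝ → E} {s : Set ℝ} {t : ℝ} {a : E} :
    HasVelocityWithinAt 𝓘(ℝ, E) c s t a ↔ HasDerivWithinAt c a s t :=
  hasMFDerivWithinAt_iff_hasFDerivWithinAt (f := c) (s := s) (x := t)
    (f' := ContinuousLinearMap.toSpanSingleton ℝ a)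

theorem hasVelocityWithinAt_fibre {x : N} {w : ℝ → TangentSpace I x} {w' : TangentSpace I x}
    {s : Set ℝ} {t : ℝ} (hw : HasDerivWithinAt (F := E) w w' s t) :
    HasVelocityWithinAt I.tangent (fun t => (⟨x, w t⟩ : TangentBundle I N)) s t
      (liftVec ⟨x, w t⟩ 0 w') := by
  have hc : ContinuousWithinAt (fun t => (⟨x, w t⟩ : TangentBundle I N)) s t :=
    (FiberBundle.continuous_totalSpaceMk E (TangentSpace I) x).continuousAt.comp_continuousWithinAt
      hw.continuousWithinAt
  have h2 : (fun z => (trivializationAt E (TangentSpace I) x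
      (⟨x, w z⟩ : TangentBundle I N)).2) = w :=
    funext fun z => trivializationAt_snd_self_mk x (w z)
  have h3 := hasVelocityWithinAt_vectorSpace.2 hw
  rw [← h2] at h3
  have := HasMFDerivWithinAt.tangentBundle_mk (I := I) (J := 𝓘(ℝ, ℝ)) hc
    (A := 0) (B := velocityMap w') (hasMFDerivWithinAt_const (I := 𝓘(ℝ, ℝ)) x s t) h3
  rw [eq_velocityMap (liftMap _ _ _), liftMap_apply, velocityMap_unitVec] at this
  exact this

end TangentBundleCharts

/-! ### Local vector fields of constant direction in a chart -/

section ChartSections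

variable {E H : Type*} [NormedAddCommGroup E] [NormedSpace ℝ E] [TopologicalSpace H]
  {I : ModelWithCorners ℝ E H} {N : Type*} [TopologicalSpace N] [ChartedSpace H N]
  [IsManifold I ∞ N]

instance : IsManifold I 1 N := IsManifold.of_le (n := ∞) (by simp)

theorem symmL_trivializationAt_self (x : N) (v : E) :
    (trivializationAt E (TangentSpace I) x).symmL ℝ x v = v := by
  rw [TangentBundle.symmL_trivializationAt_eq_core (mem_chart_source H x)]
  exact (tangentBundleCore I N).coordChange_self (achart H x) x (mem_achart_source H x) v

theorem trivializationAt_snd_symmL {x y : N} (hy : y ∈ (chartAt H x).source) (v : E) :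
    (trivializationAt E (TangentSpace I) x
      (⟨y, (trivializationAt E (TangentSpace I) x).symmL ℝ y v⟩ : TangentBundle I N)).2 = v := by
  have hy' : y ∈ (trivializationAt E (TangentSpace I) x).baseSet := hy
  rw [Trivialization.symmL_apply, Trivialization.apply_mk_symm _ hy']
  exact hy'

/-- The local vector field near `x` with value `r • v` in the preferred chart at `x`. -/
def chartSection (I : ModelWithCorners ℝ E H) [IsManifold I ∞ N] (x : N)
    (v : E) (r : N → ℝ) (y : N) : TangentBundle I N :=
  ⟨y, (trivializationAt E (TangentSpace I) x).symmL ℝ y (r y • v)⟩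

theorem chartSection_self (x : N) (v : E) {r : N → ℝ} (hr : r x = 1) :
    chartSection I x v r x = ⟨x, v⟩ := by
  rw [chartSection, hr, one_smul, symmL_trivializationAt_self]

theorem chartSection_eq_smul (x : N) (v : E) (r : N → ℝ) (y : N) :
    chartSection I x v r y =
      ⟨y, r y • (trivializationAt E (TangentSpace I) x).symmL ℝ y v⟩ := by
  rw [chartSection, map_smul]

theorem trivializationAt_chartSection (x : N) (v : E) (r : N → ℝ) :
    ∀ᶠ y in 𝓝 x,
      (trivializationAt E (TangentSpace I) x (chartSection I x v r y)).2 = r y • v := by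
  filter_upwards [(chartAt H x).open_source.mem_nhds (mem_chart_source H x)] with y hy
  exact trivializationAt_snd_symmL hy _

theorem contMDiffAt_chartSection (x : N) (v : E) {r : N → ℝ}
    (hr : ContMDiffAt I 𝓘(ℝ, ℝ) ∞ r x) :
    ContMDiffAt I I.tangent ∞ (chartSection I x v r) x := by
  refine contMDiffAt_totalSpace.2 ⟨contMDiffAt_id, ?_⟩
  have h : ContMDiffAt I 𝓘(ℝ, E) ∞ (fun y => r y • v) x := hr.smul contMDiffAt_const
  exact h.congr_of_eventuallyEq (trivializationAt_chartSection (I := I) x v r)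

/-- A field with constant coordinates differentiates to `u ↦ (u, 0)`. It realises the
coordinate-horizontal vectors, which complement the vertical ones. -/
theorem hasMFDerivAt_chartSection (x : N) (v : E) :
    HasMFDerivAt I I.tangent (chartSection I x v fun _ => 1) x
      (liftMap (chartSection I x v (fun _ => 1) x) (ContinuousLinearMap.id ℝ _) 0) := by
  have hc := (contMDiffAt_chartSection (I := I) x v (r := fun _ => 1) contMDiffAt_const).continuousAt
  rw [← hasMFDerivWithinAt_univ]
  refine HasMFDerivWithinAt.tangentBundle_mk (I := I) (J := I) hc.continuousWithinAt
    (hasMFDerivWithinAt_id univ x) ?_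
  refine (hasMFDerivWithinAt_const (I := I) (v : E) univ x).congr_of_eventuallyEq ?_ ?_
  · rw [nhdsWithin_univ]
    filter_upwards [trivializationAt_chartSection (I := I) x v (fun _ => 1)] with y hy
    exact hy.trans (one_smul _ _)
  · exact (trivializationAt_chartSection (I := I) x v (fun _ => 1)).self_of_nhds.trans (one_smul _ _)

end ChartSections

/-! ### Smoothness of the metric and local unit vector fields -/

variable {M : Type*} [TopologicalSpace M] [ChartedSpace HalfPlane M] [IsManifold (𝓡∂ 2) ∞ M]

theorem contMDiffWithinAt_metric (g : Metric M) {E' H' : Type*} [NormedAddCommGroup E']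
    [NormedSpace ℝ E'] [TopologicalSpace H'] {J : ModelWithCorners ℝ E' H'} {S : Type*}
    [TopologicalSpace S] [ChartedSpace H' S] {b : S → M} {v w : ∀ y : S, TangentAt (b y)}
    {s : Set S} {y : S}
    (hv : ContMDiffWithinAt J (𝓡∂ 2).tangent ∞ (fun y => (⟨b y, v y⟩ : TM M)) s y)
    (hw : ContMDiffWithinAt J (𝓡∂ 2).tangent ∞ (fun y => (⟨b y, w y⟩ : TM M)) s y) :
    ContMDiffWithinAt J 𝓘(ℝ, ℝ) ∞ (fun y => g.inner (b y) (v y) (w y)) s y := by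
  have hb : ContMDiffWithinAt J (𝓡∂ 2) ∞ b s y := (contMDiffWithinAt_totalSpace.1 hv).1
  have : ContMDiffWithinAt J ((𝓡∂ 2).prod 𝓘(ℝ)) ∞
      (fun m ↦ TotalSpace.mk' ℝ (E := Bundle.Trivial M ℝ) (b m) (g.inner (b m) (v m) (w m)))
      s y := by
    apply ContMDiffWithinAt.clm_bundle_apply₂ (F₁ := Plane) (F₂ := Plane)
    · exact ContMDiffAt.comp_contMDiffWithinAt y g.contMDiff.contMDiffAt hb
    · exact hv
    · exact hw
  exact (contMDiffWithinAt_totalSpace.1 this).2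

theorem contMDiff_normSq (g : Metric M) :
    ContMDiff (𝓡∂ 2).tangent 𝓘(ℝ, ℝ) ∞ (normSq g) := fun _ =>
  contMDiffWithinAt_metric g (b := fun q : TM M => q.proj) (v := fun q => q.snd)
    (w := fun q => q.snd) contMDiffWithinAt_id contMDiffWithinAt_id

theorem normSq_mk_smul (g : Metric M) (x : M) (a : ℝ) (v : TangentAt x) :
    normSq g ⟨x, a • v⟩ = a ^ 2 * normSq g ⟨x, v⟩ := by
  change g.inner x (a • v) (a • v) = a ^ 2 * g.inner x v v
  rw [map_smul, map_smul, smul_apply, smul_eq_mul, smul_eq_mul, ← mul_assoc, ← sq]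

theorem normSq_chartSection (g : Metric M) (x : M) (v : Plane) (r : M → ℝ) (y : M) :
    normSq g (chartSection (𝓡∂ 2) x v r y) =
      r y ^ 2 * normSq g (chartSection (𝓡∂ 2) x v (fun _ => 1) y) := by
  rw [chartSection_eq_smul, chartSection_eq_smul, normSq_mk_smul, one_smul]

/-- A smooth local section of the unit tangent bundle through a given point. -/
theorem exists_unit_section (g : Metric M) {p : TM M} (hp : p ∈ unitTangent g) :
    ∃ σ : M → TM M, (∀ y, (σ y).proj = y) ∧ σ p.proj = p ∧
      ContMDiffAt (𝓡∂ 2) (𝓡∂ 2).tangent ∞ σ p.proj ∧ ∀ᶠ y in 𝓝 p.proj, σ y ∈ unitTangent g := by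
  obtain ⟨x, v⟩ := p
  set n : M → ℝ := fun y => normSq g (chartSection (𝓡∂ 2) x v (fun _ => 1) y) with hn
  have hn1 : n x = 1 := by
    rw [hn]; simp only; rw [chartSection_self (I := 𝓡∂ 2) (E := Plane) x v rfl]; exact hp
  have hns : ContMDiffAt (𝓡∂ 2) 𝓘(ℝ, ℝ) ∞ n x :=
    (contMDiff_normSq g).contMDiffAt.comp x
      (contMDiffAt_chartSection (I := 𝓡∂ 2) (E := Plane) x v contMDiffAt_const)
  have hpos : ∀ᶠ y in 𝓝 x, 0 < n y :=
    hns.continuousAt.eventually (lt_mem_nhds (by rw [hn1]; exact one_pos))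
  -- The squared norm scales by `r ^ 2`, so this factor normalises the chart-constant extension of
  -- `v`; it is smooth near `x` because `n x = 1`.
  set r : M → ℝ := fun y => (Real.sqrt (n y))⁻¹ with hr
  have hrs : ContMDiffAt (𝓡∂ 2) 𝓘(ℝ, ℝ) ∞ r x := by
    have h1 : ContDiffAt ℝ ∞ (fun a : ℝ => (Real.sqrt a)⁻¹) (n x) := by
      rw [hn1]
      exact ((Real.contDiffAt_sqrt one_ne_zero)).inv (by simp)
    exact h1.contMDiffAt.comp x hns
  refine ⟨chartSection (𝓡∂ 2) x v r, fun y => rfl,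
    chartSection_self (I := 𝓡∂ 2) (E := Plane) x v (by simp [hr, hn1]),
    contMDiffAt_chartSection (I := 𝓡∂ 2) (E := Plane) x v hrs, ?_⟩
  filter_upwards [hpos] with y hy
  change normSq g _ = 1
  refine (normSq_chartSection g x v r y).trans ?_
  change (Real.sqrt (n y))⁻¹ ^ 2 * n y = 1
  rw [inv_pow, Real.sq_sqrt hy.le, inv_mul_cancel₀ hy.ne']
-- The metric in a chart and the differential of the squared norm
theorem chartMetric_apply (g : Metric M) (x : M) (y a b : Plane) :
    chartMetric g x y a b = g.inner ((extChartAt (𝓡∂ 2) x).symm y)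
      ((trivializationAt Plane (fun x : M => TangentSpace (𝓡∂ 2) x) x).symmL ℝ _ a)
      ((trivializationAt Plane (fun x : M => TangentSpace (𝓡∂ 2) x) x).symmL ℝ _ b) := rfl

theorem chartMetric_symm (g : Metric M) (x : M) (y a b : Plane) :
    chartMetric g x y a b = chartMetric g x y b a := by
  rw [chartMetric_apply, chartMetric_apply, g.symm]

theorem chartMetric_extChartAt (g : Metric M) {x q : M} (hq : q ∈ (chartAt HalfPlane x).source)
    (a b : Plane) :
    chartMetric g x (extChartAt (𝓡∂ 2) x q) a b = g.inner q
      ((trivializationAt Plane (fun x : M => TangentSpace (𝓡∂ 2) x) x).symmL ℝ q a)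
      ((trivializationAt Plane (fun x : M => TangentSpace (𝓡∂ 2) x) x).symmL ℝ q b) := by
  rw [chartMetric_apply, (extChartAt (𝓡∂ 2) x).left_inv (by rwa [extChartAt_source])]

theorem normSq_chartSection_one (g : Metric M) {x q : M} (hq : q ∈ (chartAt HalfPlane x).source)
    (v : Plane) : normSq g (chartSection (𝓡∂ 2) x v (fun _ => 1) q) =
      chartMetric g x (extChartAt (𝓡∂ 2) x q) v v := by
  rw [chartMetric_extChartAt g hq, chartSection_eq_smul, one_smul]
  rfl

theorem chartMetric_extChartAt_self (g : Metric M) (x : M) (a b : Plane) :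
    chartMetric g x (extChartAt (𝓡∂ 2) x x) a b = g.inner x a b := by
  rw [chartMetric_extChartAt g (mem_chart_source HalfPlane x)]
  exact congrArg₂ (fun u w => g.inner x u w) (symmL_trivializationAt_self x a)
    (symmL_trivializationAt_self x b)

omit [IsManifold (𝓡∂ 2) ∞ M] in
theorem eventually_mem_chartAt_source_symm (x : M) :
    ∀ᶠ y in 𝓝[range (𝓡∂ 2)] (extChartAt (𝓡∂ 2) x x),
      (extChartAt (𝓡∂ 2) x).symm y ∈ (chartAt HalfPlane x).source := by
  filter_upwards [extChartAt_target_mem_nhdsWithin (I := 𝓡∂ 2) x] with y hy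
  rw [← extChartAt_source (𝓡∂ 2) x]
  exact (extChartAt (𝓡∂ 2) x).map_target hy

/-- Smoothness of `g` as a section of the bundle of bilinear forms is smoothness of its coordinate
expression in the trivialisation at `x`, which is `chartMetric` as long as the point stays in the
chart source. -/
theorem differentiableWithinAt_chartMetric (g : Metric M) (x : M) :
    DifferentiableWithinAt ℝ (chartMetric g x) (range (𝓡∂ 2)) (extChartAt (𝓡∂ 2) x x) := by
  have h1 := ((contMDiffAt_hom_bundle _).1 (g.contMDiff.contMDiffAt (x := x))).2
  have h2 : ContMDiffWithinAt 𝓘(ℝ, Plane) (𝓡∂ 2) ∞ (extChartAt (𝓡∂ 2) x).symm (range (𝓡∂ 2))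
      (extChartAt (𝓡∂ 2) x x) := contMDiffWithinAt_extChartAt_symm_range_self x
  rw [← extChartAt_to_inv (I := 𝓡∂ 2) x] at h1
  have h3 := (h1.comp_contMDiffWithinAt _ h2).contDiffWithinAt.differentiableWithinAt (by simp)
  rw [extChartAt_to_inv (I := 𝓡∂ 2) x] at h3
  have h4 : ∀ y, (extChartAt (𝓡∂ 2) x).symm y ∈ (chartAt HalfPlane x).source → chartMetric g x y =
      ContinuousLinearMap.inCoordinates Plane (fun x : M => TangentSpace (𝓡∂ 2) x)
        (Plane →L[ℝ] ℝ) (fun x : M => TangentSpace (𝓡∂ 2) x →L[ℝ] ℝ) x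
        ((extChartAt (𝓡∂ 2) x).symm y) x ((extChartAt (𝓡∂ 2) x).symm y)
        (g.inner ((extChartAt (𝓡∂ 2) x).symm y)) := by
    intro y hy
    ext a b : 2
    refine Eq.trans ?_ (inCoordinates_apply_eq₂ (F₃ := ℝ) (E₃ := Bundle.Trivial M ℝ) hy hy
      (mem_univ _)).symm
    have hy' : (extChartAt (𝓡∂ 2) x).symm y ∈
      (trivializationAt Plane (fun x : M => TangentSpace (𝓡∂ 2) x) x).baseSet := hy
    rw [chartMetric_apply, Trivialization.symmL_apply, Trivialization.symmL_apply]
    · simp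
    · exact hy'
    · exact hy'
  refine h3.congr_of_eventuallyEq ?_ ?_
  · filter_upwards [eventually_mem_chartAt_source_symm x] with y hy
    exact h4 y hy
  · exact h4 _ (by rw [extChartAt_to_inv]; exact mem_chart_source _ x)

set_option synthInstance.maxHeartbeats 200000 in
theorem hasFDerivWithinAt_chartMetric (g : Metric M) (x : M) :
    HasFDerivWithinAt (chartMetric g x) (chartMetricDeriv g x) (range (𝓡∂ 2))
      (extChartAt (𝓡∂ 2) x x) :=
  (differentiableWithinAt_chartMetric g x).hasFDerivWithinAt

set_option synthInstance.maxHeartbeats 200000 in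
theorem hasFDerivWithinAt_chartMetric_apply (g : Metric M) (x : M) (a b : Plane) :
    HasFDerivWithinAt (fun y => chartMetric g x y a b)
      (((chartMetricDeriv g x).flip a).flip b) (range (𝓡∂ 2)) (extChartAt (𝓡∂ 2) x x) := by
  have := ((hasFDerivWithinAt_chartMetric g x).clm_apply (hasFDerivWithinAt_const a _ _)).clm_apply
    (hasFDerivWithinAt_const b _ _)
  exact this.congr_fderiv (by ext; simp)

theorem chartMetricDeriv_symm (g : Metric M) (x : M) (c a b : Plane) :
    chartMetricDeriv g x c a b = chartMetricDeriv g x c b a := by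
  have h2 := hasFDerivWithinAt_chartMetric_apply g x b a
  simp only [chartMetric_symm g x _ b a] at h2
  have := (((𝓡∂ 2).uniqueDiffOn _ (mem_range_self _)).eq
    (hasFDerivWithinAt_chartMetric_apply g x a b) h2)
  exact congrArg (fun A => A c) this

theorem hasMFDerivAt_extChartAt_self (x : M) :
    HasMFDerivAt (𝓡∂ 2) 𝓘(ℝ, Plane) (extChartAt (𝓡∂ 2) x) x
      (ContinuousLinearMap.id ℝ (TangentAt x)) := by
  rw [← mfderiv_extChartAt_self]
  exact (mdifferentiableAt_extChartAt (mem_chart_source _ x)).hasMFDerivAt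

/-- The differential of `(x, v) ↦ g_x(v, v)`. -/
def normSqDeriv (g : Metric M) (p : TM M) : TangentTM p →L[ℝ] ℝ :=
  mfderiv (𝓡∂ 2).tangent 𝓘(ℝ, ℝ) (normSq g) p

theorem hasMFDerivAt_normSq (g : Metric M) (p : TM M) :
    HasMFDerivAt (𝓡∂ 2).tangent 𝓘(ℝ, ℝ) (normSq g) p (normSqDeriv g p) :=
  ((contMDiff_normSq g).mdifferentiable (by simp) p).hasMFDerivAt

theorem mem_tangentUnit (g : Metric M) (p : TM M) (ξ : TangentTM p) :
    ξ ∈ tangentUnit g p ↔ normSqDeriv g p ξ = 0 := Iff.rfl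

theorem hasDerivAt_line {E : Type*} [NormedAddCommGroup E] [NormedSpace ℝ E] (v w : E) (t : ℝ) :
    HasDerivAt (fun t : ℝ => v + t • w) w t := by
  simpa using ((hasDerivAt_id t).smul_const w).const_add v

theorem normSqDeriv_vertical (g : Metric M) (p : TM M) (w : TangentAt p.proj) :
    normSqDeriv g p (liftVec p 0 w) = 2 * g.inner p.proj p.snd w := by
  obtain ⟨x, v⟩ := p
  have hc : HasDerivWithinAt (F := Plane) (fun t : ℝ => (v + t • w : TangentAt x)) w univ
      (0 : ℝ) := (hasDerivAt_line (E := Plane) v w 0).hasDerivWithinAt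
  have hv := hasVelocityWithinAt_fibre (I := 𝓡∂ 2) (x := x) hc
  have h1 := hv.comp ((hasMFDerivAt_normSq g _).hasMFDerivWithinAt (s := univ)) (mapsTo_univ _ _)
  have h2 : HasDerivWithinAt (fun t : ℝ => normSq g ⟨x, v + t • w⟩) (2 * g.inner x v w) univ 0 := by
    have : (fun t : ℝ => normSq g ⟨x, v + t • w⟩) =
        fun t => g.inner x v v + t * (2 * g.inner x v w) + t ^ 2 * g.inner x w w := by
      funext t
      change g.inner x (v + t • w) (v + t • w) = _
      simp only [map_add, map_smul, add_apply, smul_apply, smul_eq_mul, g.symm x w v]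
      ring
    rw [this]
    exact ((((hasDerivAt_id (0 : ℝ)).mul_const (2 * g.inner x v w)).const_add (g.inner x v v)).add
      ((hasDerivAt_pow 2 (0 : ℝ)).mul_const (g.inner x w w))).congr_deriv (by simp)
      |>.hasDerivWithinAt
  have h3 := h1.unique (hasVelocityWithinAt_vectorSpace.2 h2) uniqueDiffWithinAt_univ
  -- The curve passes through `v + 0 • w`, equal to `v` only propositionally, and tangent spaces
  -- depend on the point. Generalising the vector allows the equality to be substituted; the same
  -- device recurs below.
  have key : ∀ v' : TangentAt x, v' = v →
      normSqDeriv g ⟨x, v'⟩ (liftVec ⟨x, v'⟩ 0 w) = 2 * g.inner x v w →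
      normSqDeriv g ⟨x, v⟩ (liftVec ⟨x, v⟩ 0 w) = 2 * g.inner x v w := by
    rintro _ rfl h
    exact h
  exact key _ (by rw [zero_smul, add_zero]) h3

/-- Along the chart-constant extension of `v` the squared norm is the coefficient function `g_{ij}
vⁱ vʲ` of the metric in the chart. -/
theorem normSqDeriv_horizontal (g : Metric M) (p : TM M) (u : TangentAt p.proj) :
    normSqDeriv g p (liftVec p u 0) = chartMetricDeriv g p.proj u p.snd p.snd := by
  obtain ⟨x, v⟩ := p
  have h1 := (hasMFDerivAt_normSq g _).comp x (hasMFDerivAt_chartSection (I := 𝓡∂ 2) x v)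
  have h2 := (hasFDerivWithinAt_chartMetric_apply g x v v).hasMFDerivWithinAt
  have h3 := HasMFDerivWithinAt.comp x h2 ((hasMFDerivAt_extChartAt_self x).hasMFDerivWithinAt
    (s := univ)) fun y _ => mem_range_self _
  rw [hasMFDerivWithinAt_univ] at h3
  have h4 : normSq g ∘ chartSection (𝓡∂ 2) x v (fun _ => 1) =ᶠ[𝓝 x]
      (fun y => chartMetric g x y v v) ∘ extChartAt (𝓡∂ 2) x := by
    filter_upwards [(chartAt HalfPlane x).open_source.mem_nhds (mem_chart_source _ x)] with y hy
    exact normSq_chartSection_one g hy v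
  have h5 := hasMFDerivAt_unique (h3.congr_of_eventuallyEq h4) h1
  have h6 : normSqDeriv g (chartSection (𝓡∂ 2) x v (fun _ => 1) x)
      (liftVec (chartSection (𝓡∂ 2) x v (fun _ => 1) x) u 0) = chartMetricDeriv g x u v v :=
    (congrArg (fun A => A u) h5).symm
  have key : ∀ q : TM M, q = ⟨x, v⟩ → ∀ h : q.proj = x,
      normSqDeriv g q (liftVec q (h ▸ u) 0) = chartMetricDeriv g x u v v →
      normSqDeriv g ⟨x, v⟩ (liftVec ⟨x, v⟩ u 0) = chartMetricDeriv g x u v v := by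
    rintro _ rfl _ h
    exact h
  exact key _ (chartSection_self (E := Plane) x v rfl) rfl h6

theorem normSqDeriv_liftVec (g : Metric M) (p : TM M) (u w : TangentAt p.proj) :
    normSqDeriv g p (liftVec p u w) =
      chartMetricDeriv g p.proj u p.snd p.snd + 2 * g.inner p.proj p.snd w := by
  rw [← normSqDeriv_horizontal, ← normSqDeriv_vertical, ← map_add, ← liftVec_add, add_zero,
    zero_add]

theorem horizontalLift_eq (g : Metric M) (p : TM M) (u : TangentAt p.proj) :
    horizontalLift g p u = liftVec p u (-christoffel g p.proj p.snd u) := rfl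

theorem verticalLift_eq (p : TM M) (w : TangentAt p.proj) :
    verticalLift p w = liftVec p 0 w := rfl

theorem inner_christoffel (g : Metric M) (x : M) (b a c : TangentAt x) :
    g.inner x (christoffel g x b a) c = (1 / 2 : ℝ) * (chartMetricDeriv g x a b c +
      chartMetricDeriv g x b a c - chartMetricDeriv g x c a b) := by
  have : metricForm g x (christoffel g x b a) = christoffelFirst g x b a :=
    LinearMap.ext (LinearMap.BilinForm.apply_toDual_symm_apply
      (hB := metricForm_nondegenerate g x) (christoffelFirst g x b a))
  exact congrArg (fun A => A c) this

/-- This is metric compatibility of the connection: in the Christoffel symbol paired with `v` itself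
the last two terms cancel, and what is left offsets the derivative of the metric. -/
theorem normSqDeriv_horizontalLift (g : Metric M) (p : TM M) (u : TangentAt p.proj) :
    normSqDeriv g p (horizontalLift g p u) = 0 := by
  rw [horizontalLift_eq, normSqDeriv_liftVec, map_neg, g.symm, inner_christoffel,
    chartMetricDeriv_symm g p.proj p.snd u p.snd]
  ring

/-- The canonical form in terms of the projection of a tangent vector. -/
theorem contactForm_eq (g : Metric M) (p : TM M) (ξ : TangentTM p) :
    contactForm g p ξ = g.inner p.proj (projDeriv p ξ) p.snd := by
  rw [contactForm, (hasMFDerivAt_proj_tangentBundle p).mfderiv]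
-- Complexified vectors and oriented orthonormal bases
section ComplexParts

variable {T : Type*} [AddCommGroup T] [Module ℝ T]

/-- The map `ℂ ⊗ T → T`, `z ⊗ t ↦ l z • t`. -/
def partMap (l : ℂ →ₗ[ℝ] ℝ) : ℂ ⊗[ℝ] T →ₗ[ℝ] T :=
  (TensorProduct.lid ℝ T).toLinearMap ∘ₗ l.rTensor T

theorem partMap_tmul (l : ℂ →ₗ[ℝ] ℝ) (z : ℂ) (t : T) : partMap l (z ⊗ₜ[ℝ] t) = l z • t := by
  simp [partMap]

theorem partMap_smul_tmul (l : ℂ →ₗ[ℝ] ℝ) (c z : ℂ) (t : T) :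
    partMap l (c • (z ⊗ₜ[ℝ] t)) = l (c * z) • t := by
  rw [TensorProduct.smul_tmul', smul_eq_mul, partMap_tmul]

/-- Real and imaginary part of an equation between complexified vectors. -/
theorem re_im_of_tmul_eq {s t x y z : T} {a b : ℂ}
    (h : (1 : ℂ) ⊗ₜ[ℝ] s + Complex.I ⊗ₜ[ℝ] t =
      b • ((1 : ℂ) ⊗ₜ[ℝ] x + Complex.I ⊗ₜ[ℝ] y) + a • (1 : ℂ) ⊗ₜ[ℝ] z) :
    s = b.re • x - b.im • y + a.re • z ∧ t = b.im • x + b.re • y + a.im • z := by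
  constructor
  · have := congrArg (partMap Complex.reLm) h
    simpa [smul_add, map_add, partMap_smul_tmul, partMap_tmul, sub_eq_add_neg] using this
  · have := congrArg (partMap Complex.imLm) h
    simpa [smul_add, map_add, partMap_smul_tmul, partMap_tmul] using this

end ComplexParts

theorem eq_of_inner_sub_self (g : Metric M) {x : M} {v w : TangentAt x}
    (h : g.inner x (v - w) (v - w) = 0) : v = w := by
  by_contra hne
  exact (g.pos x _ (sub_ne_zero.2 hne)).ne' h

/-- Coefficients of a vector in an orthonormal basis. -/
theorem IsOrientedOrthonormal.exists_coeff {o : SurfaceOrientation M} {g : Metric M} {x : M}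
    {e : Module.Basis (Fin 2) ℝ (TangentAt x)} (he : IsOrientedOrthonormal o g x e)
    (u w : TangentAt x) : ∃ a b c d : ℝ, u = a • e 0 + b • e 1 ∧ w = c • e 0 + d • e 1 ∧
      g.inner x u w = a * c + b * d := by
  refine ⟨e.repr u 0, e.repr u 1, e.repr w 0, e.repr w 1, ?_, ?_, ?_⟩
  · rw [← Fin.sum_univ_two (f := fun i => e.repr u i • e i), e.sum_repr]
  · rw [← Fin.sum_univ_two (f := fun i => e.repr w i • e i), e.sum_repr]
  · conv_lhs => rw [← e.sum_repr u, ← e.sum_repr w]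
    obtain ⟨_, h0, h1, h01⟩ := he
    simp only [Fin.sum_univ_two, map_add, map_smul, add_apply, smul_apply, smul_eq_mul, h0, h1, h01,
      g.symm x (e 1) (e 0)]
    ring

/-- Gram–Schmidt applied to `v` and any vector off its line, with the sign of the second vector
adjusted to the orientation. -/
theorem exists_isOrientedOrthonormal (o : SurfaceOrientation M) (g : Metric M) (x : M)
    (v : TangentAt x) (hv : g.inner x v v = 1) :
    ∃ e : Module.Basis (Fin 2) ℝ (TangentAt x), IsOrientedOrthonormal o g x e ∧ e 0 = v := by
  have hfin : Module.finrank ℝ (TangentAt x) = 2 := finrank_euclideanSpace_fin (𝕜 := ℝ) (n := 2)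
  have hv0 : v ≠ 0 := by rintro rfl; simp at hv
  obtain ⟨w, hw⟩ : ∃ w : TangentAt x, w ∉ Submodule.span ℝ {v} := by
    by_contra! h
    have h1 : Submodule.span ℝ {v} = ⊤ := Submodule.eq_top_iff'.2 h
    have h2 := finrank_span_singleton (K := ℝ) hv0
    rw [h1, finrank_top, hfin] at h2
    omega
  set w' : TangentAt x := w - g.inner x w v • v with hw'
  have hw'0 : w' ≠ 0 := fun h => hw (Submodule.mem_span_singleton.2 ⟨_, (sub_eq_zero.1 h).symm⟩)
  have hpos := g.pos x w' hw'0
  have horth : g.inner x v w' = 0 := by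
    rw [hw', map_sub, map_smul, smul_eq_mul, hv, g.symm x w v]; ring
  set r := (Real.sqrt (g.inner x w' w'))⁻¹ with hr
  have hr0 : r ≠ 0 := inv_ne_zero (Real.sqrt_ne_zero'.2 hpos)
  have hrr : r * r * g.inner x w' w' = 1 := by
    rw [hr, ← mul_inv, Real.mul_self_sqrt hpos.le, inv_mul_cancel₀ hpos.ne']
  have hli : LinearIndependent ℝ ![v, r • w'] := by
    rw [LinearIndependent.pair_iff]
    intro s t hst
    have h1 := congrArg (g.inner x v) hst
    simp only [map_add, map_smul, smul_eq_mul, hv, horth, map_zero, mul_zero, mul_one,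
      add_zero] at h1
    subst h1
    rw [zero_smul, zero_add, smul_smul, smul_eq_zero] at hst
    exact ⟨rfl, (mul_eq_zero.1 (hst.resolve_right hw'0)).resolve_right hr0⟩
  set e := basisOfLinearIndependentOfCardEqFinrank hli (by rw [hfin]; rfl) with he
  have he0 : e 0 = v := by simp [he]
  have he1 : e 1 = r • w' := by simp [he]
  have h11 : g.inner x (e 1) (e 1) = 1 := by
    rw [he1, map_smul, map_smul, smul_apply, smul_eq_mul, smul_eq_mul, ← mul_assoc, hrr]
  have h01 : g.inner x (e 0) (e 1) = 0 := by
    rw [he0, he1, map_smul, horth, smul_zero]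
  rcases e.orientation_eq_or_eq_neg (o.orient x) with h | h
  · exact ⟨e, ⟨h.symm, by rw [he0, hv], h11, h01⟩, he0⟩
  · set e' := e.unitsSMul (Function.update 1 1 (-1)) with he'
    have h0 : e' 0 = e 0 := by simp [he', Module.Basis.unitsSMul_apply]
    have h1 : e' 1 = -e 1 := by simp [he', Module.Basis.unitsSMul_apply]
    refine ⟨e', ⟨?_, ?_, ?_, ?_⟩, h0.trans he0⟩
    · rw [he', Module.Basis.orientation_neg_single, h]
    · rw [h0, he0, hv]
    · rw [h1]; simpa using h11
    · rw [h0, h1]; simpa using h01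

-- Lagrange's identity gives determinant squared equal to one, so the determinant is 1, and then `(a
-- - d)² + (b + c)² = 0`.
theorem rotation_coeff {a b c d : ℝ} (e1 : a * a + b * b = 1) (e2 : c * c + d * d = 1)
    (e3 : a * c + b * d = 0) (hdet : 0 < a * d - c * b) : d = a ∧ c = -b := by
  have e4 : (a * d - c * b) ^ 2 = 1 := by
    linear_combination (c * c + d * d) * e1 + e2 - (a * c + b * d) * e3
  have e5 : a * d - c * b = 1 := by nlinarith
  have e6 : (a - d) ^ 2 + (b + c) ^ 2 = 0 := by linear_combination e1 + e2 - 2 * e5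
  constructor
  · nlinarith [sq_nonneg (a - d), sq_nonneg (b + c)]
  · nlinarith [sq_nonneg (a - d), sq_nonneg (b + c)]

/-- Two positively oriented orthonormal bases differ by a rotation. -/
theorem IsOrientedOrthonormal.exists_rotation {o : SurfaceOrientation M} {g : Metric M} {x : M}
    {e e' : Module.Basis (Fin 2) ℝ (TangentAt x)} (he : IsOrientedOrthonormal o g x e)
    (he' : IsOrientedOrthonormal o g x e') :
    ∃ a b : ℝ, e' 0 = a • e 0 + b • e 1 ∧ e' 1 = (-b) • e 0 + a • e 1 := by
  set a := e.repr (e' 0) 0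
  set b := e.repr (e' 0) 1
  set c := e.repr (e' 1) 0
  set d := e.repr (e' 1) 1
  have h0 : e' 0 = a • e 0 + b • e 1 := by
    rw [← Fin.sum_univ_two (f := fun i => e.repr (e' 0) i • e i), e.sum_repr]
  have h1 : e' 1 = c • e 0 + d • e 1 := by
    rw [← Fin.sum_univ_two (f := fun i => e.repr (e' 1) i • e i), e.sum_repr]
  have hdet : 0 < a * d - c * b := by
    have := (Module.Basis.orientation_eq_iff_det_pos e e').1 (he.1.trans he'.1.symm)
    rwa [Module.Basis.det_apply, Matrix.det_fin_two] at this
  obtain ⟨_, g0, g1, g01⟩ := he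
  obtain ⟨_, k0, k1, k01⟩ := he'
  have g10 := (g.symm x (e 1) (e 0)).trans g01
  rw [h0] at k0 k01
  rw [h1] at k1 k01
  simp only [map_add, map_smul, add_apply, smul_apply, smul_eq_mul, g0, g1, g01, g10] at k0 k1 k01
  obtain ⟨e7, e8⟩ := rotation_coeff (a := a) (b := b) (c := c) (d := d) (by linarith)
    (by linarith) (by linarith) hdet
  exact ⟨a, b, h0, by rw [h1, e7, e8]⟩

/-- Rotating the basis multiplies `e 0 + i e 1` by the unit complex number `a - i b`, so one basis
already spans the whole line. -/
theorem antiholomorphicTangent_eq {o : SurfaceOrientation M} {g : Metric M} {x : M}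
    {e : Module.Basis (Fin 2) ℝ (TangentAt x)} (he : IsOrientedOrthonormal o g x e) :
    antiholomorphicTangent o g x =
      Submodule.span ℂ {(1 : ℂ) ⊗ₜ[ℝ] e 0 + Complex.I ⊗ₜ[ℝ] e 1} := by
  refine le_antisymm (Submodule.span_le.2 ?_) (Submodule.span_mono ?_)
  · rintro _ ⟨e', he', rfl⟩
    obtain ⟨a, b, h0, h1⟩ := he.exists_rotation he'
    refine Submodule.mem_span_singleton.2 ⟨(a : ℂ) - b * Complex.I, ?_⟩
    rw [h0, h1]
    simp only [TensorProduct.tmul_add, ← TensorProduct.smul_tmul, smul_add,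
      TensorProduct.smul_tmul', Complex.real_smul, smul_eq_mul]
    have h : ∀ (z₁ z₂ w₁ w₂ y₁ y₂ : ℂ) (s t : TangentAt x), z₁ = w₁ + y₁ → z₂ = w₂ + y₂ →
        z₁ ⊗ₜ[ℝ] s + z₂ ⊗ₜ[ℝ] t = w₁ ⊗ₜ[ℝ] s + w₂ ⊗ₜ[ℝ] t + (y₁ ⊗ₜ[ℝ] s + y₂ ⊗ₜ[ℝ] t) := by
      rintro _ _ w₁ w₂ y₁ y₂ s t rfl rfl
      rw [TensorProduct.add_tmul, TensorProduct.add_tmul]; abel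
    refine h _ _ _ _ _ _ _ _ ?_ ?_
    · push_cast; ring
    · linear_combination (-(b : ℂ)) * Complex.I_mul_I
  · rintro _ rfl
    exact ⟨e, he, rfl⟩
-- Testing derivatives along curves in the fibres
section FibreCurves

variable {E H : Type*} [NormedAddCommGroup E] [NormedSpace ℝ E] [TopologicalSpace H]
  {I : ModelWithCorners ℝ E H} {N : Type*} [TopologicalSpace N] [ChartedSpace H N]
  [IsManifold I 1 N]
  {E' H' : Type*} [NormedAddCommGroup E'] [NormedSpace ℝ E'] [TopologicalSpace H']
  {J : ModelWithCorners ℝ E' H'} {S : Type*} [TopologicalSpace S] [ChartedSpace H' S]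

theorem hasDerivWithinAt_comp_fibre {p : TangentBundle I N} {f : TangentBundle I N → ℝ}
    {u : Set (TangentBundle I N)} {f' : TangentSpace I.tangent p →L[ℝ] ℝ}
    (hf : HasMFDerivWithinAt I.tangent 𝓘(ℝ, ℝ) f u p f')
    {w : ℝ → TangentSpace I p.proj} {w' : TangentSpace I p.proj} {s : Set ℝ} {t : ℝ}
    (hwt : w t = p.snd) (hw : HasDerivWithinAt (F := E) w w' s t)
    (hu : MapsTo (fun t => (⟨p.proj, w t⟩ : TangentBundle I N)) s u) :
    HasDerivWithinAt (fun t => f ⟨p.proj, w t⟩) (f' (liftVec p 0 w')) s t := by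
  obtain ⟨x, v⟩ := p
  change ℝ → TangentSpace I x at w
  change TangentSpace I x at w'
  change w t = v at hwt
  subst hwt
  exact hasVelocityWithinAt_vectorSpace.1 ((hasVelocityWithinAt_fibre hw).comp hf hu)

/-- Both sides are the velocity of the image under `f` of one fibre curve inside `u`; no unique
differentiability of `u` is required. -/
theorem vertical_eq_of_hasMFDerivWithinAt {p : TangentBundle I N} {f : TangentBundle I N → S}
    {u : Set (TangentBundle I N)} {A B : TangentSpace I.tangent p →L[ℝ] TangentSpace J (f p)}
    (hA : HasMFDerivWithinAt I.tangent J f u p A) (hB : HasMFDerivWithinAt I.tangent J f u p B)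
    {w : ℝ → TangentSpace I p.proj} {w' : TangentSpace I p.proj} {s : Set ℝ} {t : ℝ}
    (hwt : w t = p.snd) (hw : HasDerivWithinAt (F := E) w w' s t)
    (hs : UniqueDiffWithinAt ℝ s t)
    (hu : MapsTo (fun t => (⟨p.proj, w t⟩ : TangentBundle I N)) s u) :
    A (liftVec p 0 w') = B (liftVec p 0 w') := by
  obtain ⟨x, v⟩ := p
  change ℝ → TangentSpace I x at w
  change TangentSpace I x at w'
  change w t = v at hwt
  subst hwt
  have h := hasVelocityWithinAt_fibre (I := I) (x := x) hw
  exact (h.comp hA hu).unique (h.comp hB hu) hs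

end FibreCurves

theorem unitTangent_subset_diskBundle (g : Metric M) : unitTangent g ⊆ diskBundle g :=
  fun _ h => le_of_eq h

/-- The circle through `v` with initial velocity `w`. -/
def circle {x : M} (v w : TangentAt x) (t : ℝ) : TangentAt x := Real.cos t • v + Real.sin t • w

omit [IsManifold (𝓡∂ 2) ∞ M] in
theorem circle_zero {x : M} (v w : TangentAt x) : circle v w 0 = v := by
  rw [circle, Real.cos_zero, Real.sin_zero, one_smul, zero_smul, add_zero]

omit [IsManifold (𝓡∂ 2) ∞ M] in
theorem hasDerivAt_circle {x : M} (v w : TangentAt x) (t : ℝ) :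
    HasDerivAt (F := Plane) (circle v w) (-Real.sin t • v + Real.cos t • w) t := by
  exact ((Real.hasDerivAt_cos t).smul_const (F := Plane) v).add
    ((Real.hasDerivAt_sin t).smul_const (F := Plane) w)

omit [IsManifold (𝓡∂ 2) ∞ M] in
theorem hasDerivAt_circle_zero {x : M} (v w : TangentAt x) :
    HasDerivAt (F := Plane) (circle v w) w 0 := by
  have h := hasDerivAt_circle v w 0
  have h2 : -Real.sin 0 • v + Real.cos 0 • w = w := by
    rw [Real.cos_zero, Real.sin_zero, neg_zero, one_smul, zero_smul, zero_add]
  exact HasDerivAt.congr_deriv (F := Plane) h h2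

theorem inner_circle (g : Metric M) {x : M} {v w : TangentAt x} (hv : g.inner x v v = 1)
    (hw : g.inner x w w = 1) (hvw : g.inner x v w = 0) (t : ℝ) :
    g.inner x (circle v w t) (circle v w t) = 1 := by
  simp only [circle, map_add, map_smul, add_apply, smul_apply, smul_eq_mul, hv, hw, hvw,
    g.symm x w v]
  linear_combination Real.cos_sq_add_sin_sq t

theorem circle_mem_unitTangent (g : Metric M) {x : M} {v w : TangentAt x}
    (hv : g.inner x v v = 1) (hw : g.inner x w w = 1) (hvw : g.inner x v w = 0) (t : ℝ) :
    (⟨x, circle v w t⟩ : TM M) ∈ unitTangent g := inner_circle g hv hw hvw t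

/-- Two derivatives within the unit tangent bundle agree on vertical tangent vectors. -/
theorem vertical_eq_of_unitTangent {g : Metric M} {E' H' : Type*} [NormedAddCommGroup E']
    [NormedSpace ℝ E'] [TopologicalSpace H'] {J : ModelWithCorners ℝ E' H'} {S : Type*}
    [TopologicalSpace S] [ChartedSpace H' S] {p : TM M} {f : TM M → S}
    {A B : TangentTM p →L[ℝ] TangentSpace J (f p)}
    (hA : HasMFDerivWithinAt (𝓡∂ 2).tangent J f (unitTangent g) p A)
    (hB : HasMFDerivWithinAt (𝓡∂ 2).tangent J f (unitTangent g) p B) (hp : p ∈ unitTangent g)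
    {w : TangentAt p.proj} (hw : g.inner p.proj w w = 1) (hvw : g.inner p.proj p.snd w = 0) :
    A (liftVec p 0 w) = B (liftVec p 0 w) :=
  vertical_eq_of_hasMFDerivWithinAt hA hB (w := circle p.snd w) (t := 0) (circle_zero _ _)
    (hasDerivAt_circle_zero _ _).hasDerivWithinAt uniqueDiffWithinAt_univ
    fun t _ => circle_mem_unitTangent g hp hw hvw t

/-! ### The involutive structure over unit vectors -/

theorem twist_apply (g : Metric M) (p : TM M) (u : TangentAt p.proj) :
    twist g p u = (1 - normSq g p) • u + (2 * g.inner p.proj p.snd u) • p.snd := by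
  rw [mul_smul]
  rfl

/-- The fibre of the involutive structure over a unit vector. -/
theorem exists_coeff_of_mem_twistorStructure {o : SurfaceOrientation M} {g : Metric M} {p : TM M}
    (hp : p ∈ unitTangent g) {e : Module.Basis (Fin 2) ℝ (TangentAt p.proj)}
    (he : IsOrientedOrthonormal o g p.proj e) (he0 : e 0 = p.snd) {η : ℂ ⊗[ℝ] TangentTM p}
    (hη : η ∈ twistorStructure o g p) :
    ∃ b a : ℂ, η = b • ((1 : ℂ) ⊗ₜ[ℝ] verticalLift p (e 0) + Complex.I ⊗ₜ[ℝ] verticalLift p (e 1)) +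
      a • (1 : ℂ) ⊗ₜ[ℝ] horizontalLift g p p.snd := by
  rw [twistorStructure, antiholomorphicTangent_eq he, Submodule.map_span, Submodule.map_span,
    image_singleton, image_singleton, Submodule.mem_sup] at hη
  obtain ⟨y, hy, z, hz, rfl⟩ := hη
  obtain ⟨b, rfl⟩ := Submodule.mem_span_singleton.1 hy
  obtain ⟨a, rfl⟩ := Submodule.mem_span_singleton.1 hz
  -- Over a unit vector `twist` has rank one: it doubles `v = e 0` and kills `e 1`. The horizontal
  -- summand thus shrinks to the complex line of the geodesic vector.
  have h0 : twist g p (e 0) = (2 : ℝ) • p.snd := by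
    rw [twist_apply, he0]
    have h1 : normSq g p = 1 := hp
    have h2 : g.inner p.proj p.snd p.snd = 1 := hp
    rw [h1, h2, sub_self, zero_smul, zero_add, mul_one]
  have h1 : twist g p (e 1) = 0 := by
    rw [twist_apply, ← he0, he.2.2.2]
    have h1 : normSq g p = 1 := hp
    rw [h1, sub_self, zero_smul, zero_add, mul_zero, zero_smul]
  refine ⟨b, a * 2, ?_⟩
  rw [map_add, map_add, LinearMap.baseChange_tmul, LinearMap.baseChange_tmul,
    LinearMap.baseChange_tmul, LinearMap.baseChange_tmul, LinearMap.comp_apply,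
    LinearMap.comp_apply, h0, h1, LinearMap.map_zero, TensorProduct.tmul_zero, add_zero, map_smul,
    mul_smul, TensorProduct.tmul_smul]
  congr 2

/-- `ζ` is a non-negative multiple of the positively oriented vertical unit vector tangent to the
unit tangent bundle at `q`. -/
def IsPositiveVertical (o : SurfaceOrientation M) (g : Metric M) (q : TM M) (ζ : Plane × Plane) :
    Prop :=
  ∃ e : Module.Basis (Fin 2) ℝ (TangentAt q.proj), IsOrientedOrthonormal o g q.proj e ∧
    e 0 = q.snd ∧ ∃ β : ℝ, 0 ≤ β ∧ ζ = liftVec q 0 (β • e 1)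

/-- A linear map respecting the involutive structures over unit vectors respects the positive
vertical direction, under first-order boundary and contact conditions. -/
theorem isPositiveVertical_of_map_le {o : SurfaceOrientation M} {g₁ g₂ : Metric M} {p q : TM M}
    (hq : q ∈ unitTangent g₂) {A : TangentTM p →ₗ[ℝ] TangentTM q}
    (hA : (twistorStructure o g₁ p).map (A.baseChange ℂ) ≤ twistorStructure o g₂ q)
    {e : Module.Basis (Fin 2) ℝ (TangentAt p.proj)} (he : IsOrientedOrthonormal o g₁ p.proj e)
    (h₁ : normSqDeriv g₂ q (A (liftVec p 0 (e 1))) = 0)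
    (h₂ : contactForm g₂ q (A (liftVec p 0 (e 1))) = 0)
    (h₃ : 0 ≤ normSqDeriv g₂ q (A (liftVec p 0 (e 0)))) :
    IsPositiveVertical o g₂ q (A (liftVec p 0 (e 1))) := by
  have hq' : g₂.inner q.proj q.snd q.snd = 1 := hq
  obtain ⟨e', he', he'0⟩ := exists_isOrientedOrthonormal o g₂ q.proj q.snd hq
  have hmem : (1 : ℂ) ⊗ₜ[ℝ] A (liftVec p 0 (e 0)) + Complex.I ⊗ₜ[ℝ] A (liftVec p 0 (e 1)) ∈
      twistorStructure o g₂ q := by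
    refine hA (Submodule.mem_map.2 ⟨(1 : ℂ) ⊗ₜ[ℝ] verticalLift p (e 0) +
      Complex.I ⊗ₜ[ℝ] verticalLift p (e 1), ?_, ?_⟩)
    · refine Submodule.mem_sup_left (Submodule.mem_map.2 ⟨_, Submodule.subset_span
        ⟨e, he, rfl⟩, ?_⟩)
      rw [map_add, LinearMap.baseChange_tmul, LinearMap.baseChange_tmul]
    · rw [map_add, LinearMap.baseChange_tmul, LinearMap.baseChange_tmul]
      rfl
  obtain ⟨b, a, h⟩ := exists_coeff_of_mem_twistorStructure hq he' he'0 hmem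
  obtain ⟨hre, him⟩ := re_im_of_tmul_eq h
  have hv0 : normSqDeriv g₂ q (verticalLift q (e' 0)) = 2 := by
    rw [verticalLift_eq, normSqDeriv_vertical, he'0, hq', mul_one]
  have hv1 : normSqDeriv g₂ q (verticalLift q (e' 1)) = 0 := by
    rw [verticalLift_eq, normSqDeriv_vertical, ← he'0, he'.2.2.2, mul_zero]
  have hh : normSqDeriv g₂ q (horizontalLift g₂ q q.snd) = 0 := normSqDeriv_horizontalLift _ _ _
  -- Only the geodesic term survives projection to the base, so the contact form of the imaginary
  -- part is `a.im`.
  have ha : a.im = 0 := by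
    have hpv : ∀ w, projDeriv q (verticalLift q w) = 0 := fun _ => rfl
    have hph : projDeriv q (horizontalLift g₂ q q.snd) = q.snd := rfl
    have h4 : projDeriv q (A (liftVec p 0 (e 1))) = a.im • q.snd := by
      rw [him, map_add, map_add, map_smul, map_smul, (projDeriv q).map_smul, hpv, hpv, hph, smul_zero, smul_zero,
        zero_add, zero_add]
    rw [contactForm_eq, h4, (g₂.inner q.proj).map_smul, smul_apply, hq', smul_eq_mul, mul_one] at h₂
    exact h₂
  -- The differential of the squared norm is 2 on the radial vertical vector and 0 on the other two
  -- generators. On the imaginary part it is `2 * b.im`; on the real part, used for `hb'`, it is `2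
  -- * b.re`.
  have hb : b.im = 0 := by
    rw [him, map_add, map_add, map_smul, map_smul, map_smul, hv0, hv1, hh, smul_zero, smul_zero,
      add_zero, add_zero, smul_eq_mul] at h₁
    linarith
  have hb' : 0 ≤ b.re := by
    rw [hre, map_add, map_sub, map_smul, map_smul, map_smul, hv0, hv1, hh, smul_zero, smul_zero,
      add_zero, sub_zero, smul_eq_mul] at h₃
    linarith
  refine ⟨e', he', he'0, b.re, hb', ?_⟩
  rw [him, ha, hb, zero_smul, zero_smul, zero_add, add_zero, verticalLift_eq, ← liftVec_smul,
    smul_zero]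
-- Descent to the base
section ConstantCurves

variable {E H : Type*} [NormedAddCommGroup E] [NormedSpace ℝ E] [TopologicalSpace H]
  {I : ModelWithCorners ℝ E H} {N : Type*} [TopologicalSpace N] [ChartedSpace H N]
  [IsManifold I 1 N]

/-- A curve with vanishing velocity is constant. -/
theorem eq_of_velocity_eq_zero {c : ℝ → N} (hc : ∀ t, HasVelocityWithinAt I c univ t 0) (s t : ℝ) :
    c s = c t := by
  have hloc : IsLocallyConstant c := by
    rw [IsLocallyConstant.iff_eventually_eq]
    intro t₀
    have hcont : Continuous c := continuous_iff_continuousAt.2 fun t =>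
      (hasMFDerivWithinAt_univ.1 (hc t)).continuousAt
    have hopen : IsOpen (c ⁻¹' (extChartAt I (c t₀)).source) :=
      (isOpen_extChartAt_source (c t₀)).preimage hcont
    obtain ⟨ε, hε, hball⟩ := Metric.isOpen_iff.1 hopen t₀ (mem_extChartAt_source (c t₀))
    filter_upwards [Metric.ball_mem_nhds t₀ hε] with t ht
    have hderiv : ∀ r ∈ Metric.ball t₀ ε,
        HasFDerivWithinAt (fun r => extChartAt I (c t₀) (c r)) (0 : ℝ →L[ℝ] E)
          (Metric.ball t₀ ε) r := by
      intro r hr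
      have hs : c r ∈ (chartAt H (c t₀)).source := by
        rw [← extChartAt_source I]; exact hball hr
      have h1 := (hc r).comp ((mdifferentiableAt_extChartAt (I := I) hs).hasMFDerivAt
        |>.hasMFDerivWithinAt (s := univ)) (mapsTo_univ _ _)
      rw [map_zero] at h1
      have h2 := hasVelocityWithinAt_vectorSpace.1 h1
      exact (h2.mono (subset_univ _)).hasFDerivWithinAt.congr_fderiv (by
        ext
        exact smul_zero (1 : ℝ))
    have h2 := (convex_ball t₀ ε).is_const_of_fderivWithin_eq_zero (𝕜 := ℝ)
      (fun r hr => (hderiv r hr).differentiableWithinAt)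
      (fun r hr => (hderiv r hr).fderivWithin (Metric.isOpen_ball.uniqueDiffWithinAt hr))
      ht (Metric.mem_ball_self hε)
    exact (extChartAt I (c t₀)).injOn (hball ht) (mem_extChartAt_source _) h2
  exact hloc.apply_eq_of_preconnectedSpace s t

end ConstantCurves

/-- The unit vectors at `x` form one circle, so a curve of the form `circle` joins any two of them;
this is the connectedness of the fibre used for descent. -/
theorem exists_circle_eq (o : SurfaceOrientation M) (g : Metric M) {x : M} {v w : TangentAt x}
    (hv : g.inner x v v = 1) (hw : g.inner x w w = 1) :
    ∃ v', g.inner x v' v' = 1 ∧ g.inner x v v' = 0 ∧ ∃ t, circle v v' t = w := by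
  obtain ⟨e, he, rfl⟩ := exists_isOrientedOrthonormal o g x v hv
  obtain ⟨a, b, c, d, h1, h2, h3⟩ := he.exists_coeff w w
  have hab : a * a + b * b = 1 := by
    obtain ⟨_, g0, g1, g01⟩ := he
    have g10 := (g.symm x (e 1) (e 0)).trans g01
    have := hw
    rw [h1] at this
    simpa [g0, g1, g01, g10] using this
  -- The coordinates of `w` form a complex number of modulus one, whose argument is the time at
  -- which the circle reaches `w`.
  refine ⟨e 1, he.2.2.1, he.2.2.2, Complex.arg ⟨a, b⟩, ?_⟩
  have hn : ‖(⟨a, b⟩ : ℂ)‖ = 1 := by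
    rw [← sq_eq_sq₀ (norm_nonneg _) zero_le_one, Complex.sq_norm, Complex.normSq_mk, hab, one_pow]
  have h0 : (⟨a, b⟩ : ℂ) ≠ 0 := by rw [← norm_ne_zero_iff, hn]; exact one_ne_zero
  rw [circle, Complex.cos_arg h0, Complex.sin_arg, hn, div_one, div_one, h1]

theorem exists_smul_unit (g : Metric M) {x : M} {w : TangentAt x} (hw : w ≠ 0) :
    ∃ k : ℝ, 0 < k ∧ k * k * g.inner x w w = 1 ∧ g.inner x (k • w) (k • w) = 1 := by
  have hpos := g.pos x w hw
  have h : (Real.sqrt (g.inner x w w))⁻¹ * (Real.sqrt (g.inner x w w))⁻¹ * g.inner x w w = 1 := by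
    rw [← mul_inv, Real.mul_self_sqrt hpos.le, inv_mul_cancel₀ hpos.ne']
  refine ⟨_, inv_pos.2 (Real.sqrt_pos.2 hpos), h, ?_⟩
  rw [map_smul, map_smul, smul_apply, smul_eq_mul, smul_eq_mul, ← mul_assoc, h]

theorem exists_unit_vector (g : Metric M) (x : M) : ∃ v : TangentAt x, g.inner x v v = 1 := by
  obtain ⟨w, hw⟩ : ∃ w : TangentAt x, w ≠ 0 := exists_ne (α := Plane) 0
  obtain ⟨k, _, _, h⟩ := exists_smul_unit g hw
  exact ⟨_, h⟩

/-- A smooth map between unit tangent bundles which respects the vertical directions covers a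
smooth map of the base. -/
theorem exists_base_map (o : SurfaceOrientation M) {g : Metric M} {Φ : TM M → TM M}
    (hΦ : ContMDiffOn (𝓡∂ 2).tangent (𝓡∂ 2).tangent ∞ Φ (unitTangent g))
    (hvert : ∀ p ∈ unitTangent g, ∀ w : TangentAt p.proj, g.inner p.proj w w = 1 →
      g.inner p.proj p.snd w = 0 → projDeriv (Φ p) (mfderivWithin (𝓡∂ 2).tangent (𝓡∂ 2).tangent Φ
        (unitTangent g) p (liftVec p 0 w)) = 0) :
    ∃ f : M → M, ContMDiff (𝓡∂ 2) (𝓡∂ 2) ∞ f ∧ ∀ p ∈ unitTangent g, (Φ p).proj = f p.proj := by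
  -- Along a fibre circle the foot point of `Φ` has zero velocity, because the velocity of the
  -- circle is a unit vector orthogonal to its position.
  have hfib : ∀ p ∈ unitTangent g, ∀ q ∈ unitTangent g, p.proj = q.proj →
      (Φ p).proj = (Φ q).proj := by
    rintro ⟨x, v⟩ hv ⟨y, w⟩ hw (rfl : x = y)
    obtain ⟨v', hv', hvv', t, rfl⟩ := exists_circle_eq o g hv hw
    have hmem := circle_mem_unitTangent g hv hv' hvv'
    have hvel : ∀ t, HasVelocityWithinAt (𝓡∂ 2) (fun t => (Φ ⟨x, circle v v' t⟩).proj) univ t 0 := by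
      intro t
      have h1 := hasVelocityWithinAt_fibre (I := 𝓡∂ 2) (x := x)
        (hasDerivAt_circle v v' t).hasDerivWithinAt (s := univ)
      have h2 := ((hΦ _ (hmem t)).mdifferentiableWithinAt (by simp)).hasMFDerivWithinAt
      have h3 := (h1.comp h2 fun t _ => hmem t).comp
        (hasMFDerivWithinAt_proj_tangentBundle _ univ) (mapsTo_univ _ _)
      rw [hvert _ (hmem t)] at h3
      · exact h3
      · change g.inner x _ _ = 1
        simp only [map_add, map_smul, add_apply, smul_apply, smul_eq_mul, hv', hvv',
          g.symm x v' v, show g.inner x v v = 1 from hv]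
        linear_combination Real.cos_sq_add_sin_sq t
      · change g.inner x (circle v v' t) _ = 0
        simp only [circle, map_add, map_smul, add_apply, smul_apply, smul_eq_mul, hv', hvv',
          g.symm x v' v, show g.inner x v v = 1 from hv]
        ring
    have := eq_of_velocity_eq_zero hvel 0 t
    simpa only [circle_zero] using this
  -- `V` need not be continuous. Smoothness comes from replacing it near each point by a smooth unit
  -- section, which by `hfib` changes nothing.
  choose V hV using exists_unit_vector g
  refine ⟨fun x => (Φ ⟨x, V x⟩).proj, fun x => ?_, fun p hp => hfib _ hp _ (hV _) rfl⟩
  have hp : (⟨x, V x⟩ : TM M) ∈ unitTangent g := hV x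
  obtain ⟨σ, hσ, hσx, hσs, hσm⟩ := exists_unit_section g hp
  have h1 : ContMDiffWithinAt (𝓡∂ 2).tangent (𝓡∂ 2).tangent ∞ Φ (unitTangent g) (σ x) := by
    have h2 : σ x = ⟨x, V x⟩ := hσx
    rw [h2]; exact hΦ _ hp
  have h2 : ContMDiffWithinAt (𝓡∂ 2) (𝓡∂ 2).tangent ∞ (Φ ∘ σ) {y | σ y ∈ unitTangent g} x :=
    h1.comp x hσs.contMDiffWithinAt fun y hy => hy
  have h3 := (h2.contMDiffAt hσm)
  have h4 : ContMDiffAt (𝓡∂ 2) (𝓡∂ 2) ∞ (fun y => (Φ (σ y)).proj) x :=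
    (contMDiffAt_proj (TangentSpace (𝓡∂ 2))).comp x h3
  refine h4.congr_of_eventuallyEq ?_
  filter_upwards [hσm] with y hy
  exact hfib _ (hV _) _ hy (hσ y).symm
-- Holomorphic maps at the boundary
theorem line_mem_diskBundle {g : Metric M} {p : TM M} (hp : p ∈ unitTangent g) :
    ∀ t ∈ Icc (0 : ℝ) 1, (⟨p.proj, p.snd + t • (-p.snd)⟩ : TM M) ∈ diskBundle g := by
  rintro t ⟨h0, h1⟩
  have h : p.snd + t • (-p.snd) = (1 - t) • p.snd := by
    rw [sub_smul, one_smul, smul_neg, sub_eq_add_neg]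
  rw [h]
  change normSq g _ ≤ 1
  have hp' : normSq g ⟨p.proj, p.snd⟩ = 1 := hp
  rw [normSq_mk_smul, hp', mul_one]
  nlinarith

/-- The radial derivative of a function on the disk bundle at a point where it is maximal. -/
theorem radial_deriv_nonneg {g : Metric M} {p : TM M} (hp : p ∈ unitTangent g) {f : TM M → ℝ}
    {f' : TangentTM p →L[ℝ] ℝ}
    (hf : HasMFDerivWithinAt (𝓡∂ 2).tangent 𝓘(ℝ, ℝ) f (diskBundle g) p f')
    (hmax : ∀ q ∈ diskBundle g, f q ≤ f p) : 0 ≤ f' (liftVec p 0 p.snd) := by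
  -- The segment from `v` to the zero vector enters the disk bundle with velocity `-v`, so a maximum
  -- at its start bounds the derivative in direction `-v` above by 0.
  have hw : HasDerivWithinAt (F := Plane) (fun t : ℝ => (p.snd + t • (-p.snd) : TangentAt p.proj))
      (-p.snd : TangentAt p.proj) (Icc 0 1) 0 :=
    (hasDerivAt_line (E := Plane) p.snd (-p.snd) 0).hasDerivWithinAt
  have hmem := line_mem_diskBundle hp
  have h0 : p.snd + (0 : ℝ) • (-p.snd) = p.snd := by rw [zero_smul, add_zero]
  have h := hasDerivWithinAt_comp_fibre hf h0 hw hmem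
  have hmax' : IsLocalMaxOn (fun t : ℝ => f ⟨p.proj, p.snd + t • (-p.snd)⟩) (Icc 0 1) 0 := by
    filter_upwards [self_mem_nhdsWithin] with t ht
    have := hmax _ (hmem t ht)
    rw [h0]
    exact this
  have h1 := hmax'.hasFDerivWithinAt_nonpos h.hasFDerivWithinAt
    (y := 1) (mem_posTangentConeAt_of_segment_subset (by
      rw [zero_add, segment_eq_Icc zero_le_one]))
  have h2 : liftVec p 0 (-p.snd) = -liftVec p 0 p.snd := by
    have := liftVec_smul p (-1) 0 p.snd
    rwa [smul_zero, neg_one_smul, neg_one_smul] at this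
  rw [h2, map_neg] at h1
  have h3 : (1 : ℝ) • (-f' (liftVec p 0 p.snd)) ≤ 0 := h1
  rw [one_smul] at h3
  linarith

theorem vertical_deriv_eq_zero {g : Metric M} {p : TM M} (hp : p ∈ unitTangent g) {f : TM M → ℝ}
    {f' : TangentTM p →L[ℝ] ℝ}
    (hf : HasMFDerivWithinAt (𝓡∂ 2).tangent 𝓘(ℝ, ℝ) f (unitTangent g) p f')
    (hconst : ∀ q ∈ unitTangent g, f q = f p) {w : TangentAt p.proj}
    (hw : g.inner p.proj w w = 1) (hvw : g.inner p.proj p.snd w = 0) :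
    f' (liftVec p 0 w) = 0 := by
  have h0 : HasMFDerivWithinAt (𝓡∂ 2).tangent 𝓘(ℝ, ℝ) f (unitTangent g) p
      (0 : TangentTM p →L[ℝ] ℝ) :=
    (hasMFDerivWithinAt_const (I := (𝓡∂ 2).tangent) (f p) (unitTangent g) p).congr_of_eventuallyEq
      (by filter_upwards [self_mem_nhdsWithin] with q hq using hconst q hq) rfl
  exact vertical_eq_of_unitTangent hf h0 hp hw hvw

/-- The three conditions of `isPositiveVertical_of_map_le` hold because `Φ` keeps the squared norm
equal to 1 on unit vectors, pulls back a form that vanishes on vertical vectors, and has image norm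
at most 1. -/
theorem isPositiveVertical_mfderivWithin {o : SurfaceOrientation M} {g₁ g₂ : Metric M}
    {Φ : TM M → TM M}
    (hΦ : ContMDiffOn (𝓡∂ 2).tangent (𝓡∂ 2).tangent ∞ Φ (diskBundle g₁))
    (hmaps : MapsTo Φ (diskBundle g₁) (diskBundle g₂)) (hhol : IsHolomorphicOn o g₁ g₂ Φ)
    (hunit : MapsTo Φ (unitTangent g₁) (unitTangent g₂)) (hα : PullsBackContactForm g₁ g₂ Φ)
    {p : TM M} (hp : p ∈ unitTangent g₁) {e : Module.Basis (Fin 2) ℝ (TangentAt p.proj)}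
    (he : IsOrientedOrthonormal o g₁ p.proj e) (he0 : e 0 = p.snd) :
    IsPositiveVertical o g₂ (Φ p) (mfderivWithin (𝓡∂ 2).tangent (𝓡∂ 2).tangent Φ
        (unitTangent g₁) p (liftVec p 0 (e 1))) := by
  have hpZ := unitTangent_subset_diskBundle g₁ hp
  have hL := ((hΦ p hpZ).mdifferentiableWithinAt (by simp)).hasMFDerivWithinAt
  have hLS := hL.mono (unitTangent_subset_diskBundle g₁)
  set L := mfderivWithin (𝓡∂ 2).tangent (𝓡∂ 2).tangent Φ (diskBundle g₁) p
  have hvw : g₁.inner p.proj p.snd (e 1) = 0 := by rw [← he0]; exact he.2.2.2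
  have hS := (hLS.mdifferentiableWithinAt).hasMFDerivWithinAt
  -- Holomorphy concerns the derivative within the disk bundle, the contact condition the one within
  -- the unit tangent bundle; on the fibre circle direction they agree.
  have hLe := vertical_eq_of_unitTangent hLS hS hp he.2.2.1 hvw
  have hq : normSq g₂ (Φ p) = 1 := hunit hp
  rw [← hLe]
  refine isPositiveVertical_of_map_le (A := L.toLinearMap) (hunit hp) (hhol p hpZ) he ?_ ?_ ?_
  · refine vertical_deriv_eq_zero (f := normSq g₂ ∘ Φ) hp
      ((hasMFDerivAt_normSq g₂ (Φ p)).comp_hasMFDerivWithinAt p hLS) (fun q hq' => ?_)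
      he.2.2.1 hvw
    have h2 : normSq g₂ (Φ q) = 1 := hunit hq'
    simp only [Function.comp_apply, h2, hq]
  · have hmem : liftVec p 0 (e 1) ∈ tangentUnit g₁ p := by
      rw [mem_tangentUnit, normSqDeriv_vertical, hvw, mul_zero]
    have h1 := hα p hp _ hmem
    rw [← hLe, contactForm_eq g₁, projDeriv_liftVec, map_zero] at h1
    exact h1
  · rw [he0]
    refine radial_deriv_nonneg (f := normSq g₂ ∘ Φ) hp
      ((hasMFDerivAt_normSq g₂ (Φ p)).comp_hasMFDerivWithinAt p hL) fun q hq' => ?_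
    have h2 : normSq g₂ (Φ q) ≤ 1 := hmaps hq'
    simpa only [Function.comp_apply, hq] using h2

theorem PullsBackContactForm.congr {g₁ g₂ : Metric M} {φ Φ : TM M → TM M}
    (hα : PullsBackContactForm g₁ g₂ φ) (h : EqOn Φ φ (unitTangent g₁)) :
    PullsBackContactForm g₁ g₂ Φ := by
  intro p hp ξ hξ
  rw [← hα p hp ξ hξ]
  -- The two values lie in tangent spaces at `Φ p` and `φ p`; both are `Plane × Plane`, where they
  -- are compared before the points are identified.
  have h1 : (mfderivWithin (𝓡∂ 2).tangent (𝓡∂ 2).tangent Φ (unitTangent g₁) p ξ : Plane × Plane) =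
      mfderivWithin (𝓡∂ 2).tangent (𝓡∂ 2).tangent φ (unitTangent g₁) p ξ :=
    congrArg (fun A => A ξ) (mfderivWithin_congr (f₁ := Φ) (f := φ) (I := (𝓡∂ 2).tangent)
      (I' := (𝓡∂ 2).tangent) h (h hp))
  exact congrArg₂ (fun (q : TM M) (ζ : Plane × Plane) => contactForm g₂ q ζ) (h hp) h1

/-- A vector orthogonal to `e 0` is a multiple of `e 1`. -/
theorem IsOrientedOrthonormal.eq_smul {o : SurfaceOrientation M} {g : Metric M} {x : M}
    {e : Module.Basis (Fin 2) ℝ (TangentAt x)} (he : IsOrientedOrthonormal o g x e)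
    {w : TangentAt x} (hw : g.inner x (e 0) w = 0) : ∃ d : ℝ, w = d • e 1 := by
  obtain ⟨a, b, c, d, _, h2, _⟩ := he.exists_coeff w w
  refine ⟨d, ?_⟩
  rw [h2, map_add, map_smul, map_smul, he.2.1, he.2.2.2, smul_eq_mul, smul_eq_mul, mul_one,
    mul_zero, add_zero] at hw
  rw [h2, hw, zero_smul, zero_add]
-- Tangent maps on fibres and the contact identity on the base
theorem contMDiff_tangentMap_infty {f : M → M} (hf : ContMDiff (𝓡∂ 2) (𝓡∂ 2) ∞ f) :
    ContMDiff (𝓡∂ 2).tangent (𝓡∂ 2).tangent ∞ (tangentMap (𝓡∂ 2) (𝓡∂ 2) f) :=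
  hf.contMDiff_tangentMap (by simp)

theorem hasMFDerivAt_tangentMap {f : M → M} (hf : ContMDiff (𝓡∂ 2) (𝓡∂ 2) ∞ f) (p : TM M) :
    HasMFDerivAt (𝓡∂ 2).tangent (𝓡∂ 2).tangent (tangentMap (𝓡∂ 2) (𝓡∂ 2) f) p
      (mfderiv (𝓡∂ 2).tangent (𝓡∂ 2).tangent (tangentMap (𝓡∂ 2) (𝓡∂ 2) f) p) :=
  ((contMDiff_tangentMap_infty hf).mdifferentiable (by simp) p).hasMFDerivAt

/-- The tangent map is linear on fibres, so it takes the line `v + t • w` to a line in the fibre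
over `f x`. -/
theorem mfderiv_tangentMap_vertical {f : M → M} (hf : ContMDiff (𝓡∂ 2) (𝓡∂ 2) ∞ f) (p : TM M)
    (w : TangentAt p.proj) :
    mfderiv (𝓡∂ 2).tangent (𝓡∂ 2).tangent (tangentMap (𝓡∂ 2) (𝓡∂ 2) f) p (liftVec p 0 w) =
      liftVec (tangentMap (𝓡∂ 2) (𝓡∂ 2) f p) 0 (mfderiv (𝓡∂ 2) (𝓡∂ 2) f p.proj w) := by
  obtain ⟨x, v⟩ := p
  change TangentAt x at w
  set c : ℝ → TangentAt x := fun t => v + t • w with hc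
  have hc' : HasDerivAt (F := Plane) c w 0 := hasDerivAt_line (E := Plane) v w 0
  have hd : HasDerivAt (F := Plane) (fun t => mfderiv (𝓡∂ 2) (𝓡∂ 2) f x (c t))
      (mfderiv (𝓡∂ 2) (𝓡∂ 2) f x w) 0 :=
    HasFDerivAt.comp_hasDerivAt (E := Plane) (F := Plane) 0
      (ContinuousLinearMap.hasFDerivAt (E := Plane) (F := Plane) (mfderiv (𝓡∂ 2) (𝓡∂ 2) f x)) hc'
  have h : ∀ v', v' = c 0 →
      mfderiv (𝓡∂ 2).tangent (𝓡∂ 2).tangent (tangentMap (𝓡∂ 2) (𝓡∂ 2) f) (⟨x, v'⟩ : TM M)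
        (liftVec ⟨x, v'⟩ 0 w) =
      liftVec (tangentMap (𝓡∂ 2) (𝓡∂ 2) f ⟨x, v'⟩) 0 (mfderiv (𝓡∂ 2) (𝓡∂ 2) f x w) := by
    rintro _ rfl
    have h1 := hasVelocityWithinAt_fibre (I := 𝓡∂ 2) (x := x) (s := univ) hc'.hasDerivWithinAt
    have h2 := h1.comp (hasMFDerivAt_tangentMap hf _).hasMFDerivWithinAt (mapsTo_univ _ univ)
    have h3 := hasVelocityWithinAt_fibre (I := 𝓡∂ 2) (x := f x) (s := univ) hd.hasDerivWithinAt
    exact h2.unique h3 uniqueDiffWithinAt_univ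
  exact h v (by simp only [hc, zero_smul, add_zero])

/-- If `Φ` pulls back the contact form and covers `f`, then `g₂(df(u), Φ(v)) = g₁(u, v)`. -/
theorem inner_mfderiv_base_map {g₁ g₂ : Metric M} {Φ : TM M → TM M}
    (hΦ : ContMDiffOn (𝓡∂ 2).tangent (𝓡∂ 2).tangent ∞ Φ (unitTangent g₁))
    (hα : PullsBackContactForm g₁ g₂ Φ) {f : M → M} (hf : ContMDiff (𝓡∂ 2) (𝓡∂ 2) ∞ f)
    (hfΦ : ∀ p ∈ unitTangent g₁, (Φ p).proj = f p.proj) {p : TM M} (hp : p ∈ unitTangent g₁)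
    {w : TangentAt (f p.proj)} (hw : Φ p = ⟨f p.proj, w⟩) (u : TangentAt p.proj) :
    g₂.inner (f p.proj) (mfderiv (𝓡∂ 2) (𝓡∂ 2) f p.proj u) w = g₁.inner p.proj u p.snd := by
  -- A unit section lifts `u` to a vector tangent to the unit tangent bundle, where the contact
  -- condition applies; its image projects to `df u` because `π ∘ Φ ∘ σ = f` near `x`.
  obtain ⟨σ, hσ, hσx, hσs, hσm⟩ := exists_unit_section g₁ hp
  obtain ⟨x, v⟩ := p
  change TangentAt (f x) at w
  change TangentAt x at u
  change σ x = _ at hσx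
  have hσp : σ x ∈ unitTangent g₁ := by rw [hσx]; exact hp
  have hσd := (hσs.mdifferentiableAt (by simp)).hasMFDerivAt
  set D := mfderiv (𝓡∂ 2) (𝓡∂ 2).tangent σ x with hD
  have h1 : projDeriv (σ x) (D u) = u := by
    have h2 := (hasMFDerivAt_proj_tangentBundle (I := 𝓡∂ 2) (σ x)).comp x hσd
    have h3 : (fun q : TM M => q.proj) ∘ σ = id := funext hσ
    rw [h3] at h2
    exact congrArg (fun A => A u) (hasMFDerivAt_unique h2 (hasMFDerivAt_id x))
  have h2 : normSqDeriv g₁ (σ x) (D u) = 0 := by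
    have h2 := (hasMFDerivAt_normSq g₁ (σ x)).comp x hσd
    have h3 : normSq g₁ ∘ σ =ᶠ[𝓝 x] fun _ => (1 : ℝ) := by
      filter_upwards [hσm] with y hy using hy
    have h4 := (hasMFDerivAt_const (I := 𝓡∂ 2) (I' := 𝓘(ℝ, ℝ)) (1 : ℝ) x).congr_of_eventuallyEq h3
    exact congrArg (fun A => A u) (hasMFDerivAt_unique h2 h4)
  have hdΦ := ((hΦ _ hσp).mdifferentiableWithinAt (by simp)).hasMFDerivWithinAt
  have h3 : projDeriv (Φ (σ x)) (mfderivWithin (𝓡∂ 2).tangent (𝓡∂ 2).tangent Φ (unitTangent g₁)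
      (σ x) (D u)) = mfderiv (𝓡∂ 2) (𝓡∂ 2) f x u := by
    have h4 := ((hasMFDerivAt_proj_tangentBundle (I := 𝓡∂ 2) (Φ (σ x))).comp_hasMFDerivWithinAt
      (σ x) hdΦ)
    have h5 := (HasMFDerivWithinAt.comp x (s := σ ⁻¹' unitTangent g₁) h4
      hσd.hasMFDerivWithinAt subset_rfl).hasMFDerivAt hσm
    have h6 : f =ᶠ[𝓝 x] ((fun q : TM M => q.proj) ∘ Φ) ∘ σ := by
      filter_upwards [hσm] with y hy
      simp only [Function.comp_apply, hfΦ _ hy, hσ]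
    exact congrArg (fun A => A u) (hasMFDerivAt_unique (h5.congr_of_eventuallyEq h6)
      (hf.mdifferentiable (by simp) x).hasMFDerivAt)
  have h4 := hα _ hσp (D u) h2
  rw [contactForm_eq, contactForm_eq, h3, h1] at h4
  have h5 : Φ (σ x) = ⟨f x, w⟩ := by rw [hσx, hw]
  have h6 := congrArg (fun q : TM M => g₂.inner q.proj (mfderiv (𝓡∂ 2) (𝓡∂ 2) f x u : Plane) q.snd) h5
  have h7 := congrArg (fun q : TM M => g₁.inner q.proj (u : Plane) q.snd) hσx
  exact h6.symm.trans (h4.trans h7)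
-- From a biholomorphism to an isometry
theorem projDeriv_eq_zero_of_isPositiveVertical {o : SurfaceOrientation M} {g : Metric M} {q : TM M}
    {ζ : TangentTM q} (h : IsPositiveVertical o g q ζ) : projDeriv q ζ = 0 := by
  obtain ⟨e, _, _, β, _, hζ⟩ := h
  exact congrArg (fun z : TangentTM q => projDeriv q z) hζ

/-- A map of unit tangent bundles whose inverse respects vertical directions does so itself. -/
theorem projDeriv_mfderivWithin_inverse {o : SurfaceOrientation M} {g₁ g₂ : Metric M}
    {Φ Ψ : TM M → TM M}
    (hΦ : ContMDiffOn (𝓡∂ 2).tangent (𝓡∂ 2).tangent ∞ Φ (unitTangent g₁))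
    (hΨ : ContMDiffOn (𝓡∂ 2).tangent (𝓡∂ 2).tangent ∞ Ψ (unitTangent g₂))
    (hm : MapsTo Φ (unitTangent g₁) (unitTangent g₂)) {p : TM M} (hp : p ∈ unitTangent g₁)
    (hinv : ∀ p ∈ unitTangent g₁, Ψ (Φ p) = p)
    (hpos : ∀ e : Module.Basis (Fin 2) ℝ (TangentAt p.proj), IsOrientedOrthonormal o g₁ p.proj e →
      e 0 = p.snd → IsPositiveVertical o g₂ (Φ p) (mfderivWithin (𝓡∂ 2).tangent (𝓡∂ 2).tangent Φ
        (unitTangent g₁) p (liftVec p 0 (e 1))))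
    {w : TangentAt (Φ p).proj} (hvw : g₂.inner (Φ p).proj (Φ p).snd w = 0) :
    projDeriv (Ψ (Φ p)) (mfderivWithin (𝓡∂ 2).tangent (𝓡∂ 2).tangent Ψ (unitTangent g₂) (Φ p)
      (liftVec (Φ p) 0 w)) = 0 := by
  obtain ⟨e, he, he0⟩ := exists_isOrientedOrthonormal o g₁ p.proj p.snd hp
  obtain ⟨e', he', he'0, β, _, hβ⟩ := hpos e he he0
  rw [← he'0] at hvw
  obtain ⟨d, rfl⟩ := he'.eq_smul hvw
  have hdΦ := ((hΦ _ hp).mdifferentiableWithinAt (by simp)).hasMFDerivWithinAt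
  have hdΨ := ((hΨ _ (hm hp)).mdifferentiableWithinAt (by simp)).hasMFDerivWithinAt
  set B := mfderivWithin (𝓡∂ 2).tangent (𝓡∂ 2).tangent Ψ (unitTangent g₂) (Φ p) with hB
  have hcomp := HasMFDerivWithinAt.comp p hdΨ hdΦ hm
  have hid := (hasMFDerivWithinAt_id (I := (𝓡∂ 2).tangent) (unitTangent g₁) p).congr_of_eventuallyEq
    (f₁ := Ψ ∘ Φ) (by filter_upwards [self_mem_nhdsWithin] with q hq using hinv q hq) (hinv p hp)
  have heq := vertical_eq_of_unitTangent hcomp hid hp he.2.2.1 (by rw [← he0]; exact he.2.2.2)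
  have h1 : (B (liftVec (Φ p) 0 (β • e' 1)) : Plane × Plane) = liftVec p 0 (e 1) :=
    (congrArg (fun z : TangentTM (Φ p) => B z) hβ).symm.trans heq
  have h2 : ∀ c : ℝ, B (liftVec (Φ p) 0 (c • e' 1)) = c • B (liftVec (Φ p) 0 (e' 1)) := fun c => by
    have := liftVec_smul (Φ p) c 0 (e' 1)
    rw [smul_zero] at this
    rw [this, map_smul]
  -- Differentiating `Ψ ∘ Φ = id` along the fibre circle shows that `dΨ` maps `β` times the vertical
  -- unit vector to a non-zero vertical vector. So `β ≠ 0`, and dividing by it makes `dΨ` of the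
  -- unit vector vertical.
  have hβ0 : β ≠ 0 := by
    rintro rfl
    rw [h2, zero_smul] at h1
    exact e.ne_zero 1 (congrArg Prod.snd h1).symm
  have h3 : β • projDeriv (Ψ (Φ p)) (B (liftVec (Φ p) 0 (e' 1))) = 0 := by
    rw [← map_smul, ← h2]
    exact congrArg Prod.fst h1
  rw [h2, map_smul, (smul_eq_zero.1 h3).resolve_left hβ0, smul_zero]

theorem metric_ext_of_unit {g₁ g₂ : Metric M} {x y : M} (A : TangentAt x →L[ℝ] TangentAt y)
    (h : ∀ v, g₁.inner x v v = 1 → ∀ u, g₂.inner y (A u) (A v) = g₁.inner x u v)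
    (u w : TangentAt x) : g₂.inner y (A u) (A w) = g₁.inner x u w := by
  rcases eq_or_ne w 0 with rfl | hw
  · simp
  · obtain ⟨k, hk, _, h1⟩ := exists_smul_unit g₁ hw
    have h2 := h _ h1 u
    rw [map_smul, map_smul, map_smul, smul_eq_mul, smul_eq_mul] at h2
    exact mul_left_cancel₀ hk.ne' h2

/-- A linear map `A` whose adjoint maps `w` to `v`, and every unit vector to a unit vector, maps `v`
to `w`. -/
theorem mfderiv_eq_of_inner {g₁ g₂ : Metric M} {x y : M} (A : TangentAt x →L[ℝ] TangentAt y)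
    {v : TangentAt x} {w : TangentAt y} (hv : g₁.inner x v v = 1) (hw : g₂.inner y w w = 1)
    (hvw : ∀ u, g₂.inner y (A u) w = g₁.inner x u v)
    (hsurj : ∀ w', g₂.inner y w' w' = 1 → ∃ v', g₁.inner x v' v' = 1 ∧
      ∀ u, g₂.inner y (A u) w' = g₁.inner x u v') : A v = w := by
  have h1 : g₂.inner y (A v) w = 1 := (hvw v).trans hv
  have h0 : A v ≠ 0 := fun h => by
    rw [h, map_zero, zero_apply] at h1
    exact zero_ne_one h1
  obtain ⟨k, hk, hkk, hunit⟩ := exists_smul_unit g₂ h0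
  -- Testing on the normalised vector `A v / |A v|` gives `|A v| = g₁(v, v')`, which is at most 1 by
  -- Cauchy–Schwarz.
  obtain ⟨v', hv', h2⟩ := hsurj _ hunit
  have h3 := h2 v
  rw [map_smul, smul_eq_mul] at h3
  have h4 : g₁.inner x v v' ≤ 1 := by
    have h5 : 0 ≤ g₁.inner x (v - v') (v - v') := by
      rcases eq_or_ne (v - v') 0 with h | h
      · rw [h, map_zero]
      · exact (g₁.pos x _ h).le
    simp only [map_sub, sub_apply, hv, hv', g₁.symm x v' v] at h5
    linarith
  apply eq_of_inner_sub_self g₂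
  have hpos := g₂.pos y _ h0
  have h6 : g₂.inner y (A v) (A v) ≤ 1 := by
    rw [← h3] at h4
    nlinarith
  -- Since `g₂(A v, w) = 1` with `|w| = 1` and `|A v| ≤ 1`, equality holds in Cauchy–Schwarz.
  have h7 : g₂.inner y (A v - w) (A v - w) = g₂.inner y (A v) (A v) - 1 := by
    simp only [map_sub, sub_apply, h1, hw, g₂.symm y w (A v)]
    ring
  rcases eq_or_ne (A v - w) 0 with h | h
  · rw [h, map_zero]
  · have := g₂.pos y _ h
    linarith

omit [IsManifold (𝓡∂ 2) ∞ M] in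
theorem exists_eq_mk {q : TM M} {x : M} (h : q.proj = x) : ∃ v : TangentAt x, q = ⟨x, v⟩ := by
  subst h
  exact ⟨q.snd, rfl⟩

theorem eq_one_of_inner_smul {g : Metric M} {x : M} {w : TangentAt x} {b : ℝ} (hb : 0 ≤ b)
    (hw : g.inner x w w = 1) (h : g.inner x (b • w) (b • w) = 1) : b = 1 := by
  rw [map_smul, map_smul, smul_apply, smul_eq_mul, smul_eq_mul, hw] at h
  nlinarith

/-- A biholomorphism of transport twistor spaces which preserves the contact forms of the unit
tangent bundles is there the tangent map of an orientation preserving isometry. -/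
theorem exists_isometry_of_biholomorphism {o : SurfaceOrientation M} {g₁ g₂ : Metric M}
    {Φ Ψ : TM M → TM M} (hpair : IsDiffeoPair (diskBundle g₁) (diskBundle g₂) Φ Ψ)
    (hhol : IsHolomorphicOn o g₁ g₂ Φ) (hm : MapsTo Φ (unitTangent g₁) (unitTangent g₂))
    (hm' : MapsTo Ψ (unitTangent g₂) (unitTangent g₁)) (hα : PullsBackContactForm g₁ g₂ Φ) :
    ∃ f : M ≃ₘ^∞⟮𝓡∂ 2, 𝓡∂ 2⟯ M, IsOrientedIsometry o g₁ g₂ f ∧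
      EqOn Φ (tangentMap (𝓡∂ 2) (𝓡∂ 2) f) (unitTangent g₁) := by
  have hΦ := hpair.smooth.mono (unitTangent_subset_diskBundle g₁)
  have hΨ := hpair.smooth_inv.mono (unitTangent_subset_diskBundle g₂)
  have hinv : ∀ p ∈ unitTangent g₁, Ψ (Φ p) = p := fun p hp =>
    hpair.invOn.1 (unitTangent_subset_diskBundle g₁ hp)
  have hinv' : ∀ q ∈ unitTangent g₂, Φ (Ψ q) = q := fun q hq =>
    hpair.invOn.2 (unitTangent_subset_diskBundle g₂ hq)
  have hpos := fun (p : TM M) (hp : p ∈ unitTangent g₁)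
    (e : Module.Basis (Fin 2) ℝ (TangentAt p.proj)) (he : IsOrientedOrthonormal o g₁ p.proj e)
    (he0 : e 0 = p.snd) =>
    isPositiveVertical_mfderivWithin hpair.smooth hpair.mapsTo hhol hm hα hp he he0
  obtain ⟨f, hf, hfΦ⟩ := exists_base_map o hΦ (by
    intro p hp w hw hvw
    obtain ⟨e, he, he0⟩ := exists_isOrientedOrthonormal o g₁ p.proj p.snd hp
    rw [← he0] at hvw
    obtain ⟨d, rfl⟩ := he.eq_smul hvw
    have := liftVec_smul p d 0 (e 1)
    rw [smul_zero] at this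
    rw [this, map_smul, map_smul,
      projDeriv_eq_zero_of_isPositiveVertical (hpos p hp e he he0), smul_zero])
  obtain ⟨f', hf', hfΨ⟩ := exists_base_map o hΨ (by
    intro q hq w hw hvw
    have key : ∀ q', q' = q → projDeriv (Ψ q') (mfderivWithin (𝓡∂ 2).tangent (𝓡∂ 2).tangent Ψ
        (unitTangent g₂) q' (liftVec q' 0 (w : Plane))) = (0 : Plane) →
        projDeriv (Ψ q) (mfderivWithin (𝓡∂ 2).tangent (𝓡∂ 2).tangent Ψ
        (unitTangent g₂) q (liftVec q 0 w)) = 0 := by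
      rintro _ rfl h
      exact h
    refine key _ (hinv' q hq) (projDeriv_mfderivWithin_inverse hΦ hΨ hm (hm' hq) hinv
      (fun e he he0 => hpos _ (hm' hq) e he he0) ?_)
    have h1 := congrArg (fun q : TM M => g₂.inner q.proj q.snd (w : Plane)) (hinv' q hq)
    exact h1.trans hvw)
  have hff : ∀ x, f' (f x) = x := by
    intro x
    obtain ⟨v, hv⟩ := exists_unit_vector g₁ x
    have hp : (⟨x, v⟩ : TM M) ∈ unitTangent g₁ := hv
    rw [← hfΦ _ hp, ← hfΨ _ (hm hp), hinv _ hp]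
  have hff' : ∀ x, f (f' x) = x := by
    intro x
    obtain ⟨v, hv⟩ := exists_unit_vector g₂ x
    have hp : (⟨x, v⟩ : TM M) ∈ unitTangent g₂ := hv
    rw [← hfΨ _ hp, ← hfΦ _ (hm' hp), hinv' _ hp]
  have hlift : ∀ p ∈ unitTangent g₁, ∃ w : TangentAt (f p.proj), Φ p = ⟨f p.proj, w⟩ :=
    fun p hp => exists_eq_mk (hfΦ p hp)
  have hderiv : ∀ p ∈ unitTangent g₁, Φ p = tangentMap (𝓡∂ 2) (𝓡∂ 2) f p := by
    intro p hp
    obtain ⟨w, hw⟩ := hlift p hp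
    have hw1 : g₂.inner (f p.proj) w w = 1 := by
      have := hm hp
      rw [hw] at this
      exact this
    have := mfderiv_eq_of_inner (g₁ := g₁) (g₂ := g₂) (mfderiv (𝓡∂ 2) (𝓡∂ 2) f p.proj) hp hw1
      (inner_mfderiv_base_map hΦ hα hf hfΦ hp hw) (by
        intro w' hw'
        have hq : (⟨f p.proj, w'⟩ : TM M) ∈ unitTangent g₂ := hw'
        -- Every unit vector over `f x` is the image under `Φ` of a unit vector over `x`, supplied
        -- by `Ψ`; this is the surjectivity that `mfderiv_eq_of_inner` requires.
        obtain ⟨v', hv'⟩ : ∃ v' : TangentAt p.proj, Ψ ⟨f p.proj, w'⟩ = ⟨p.proj, v'⟩ :=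
          exists_eq_mk ((hfΨ _ hq).trans (hff p.proj))
        have hp' := hm' hq
        rw [hv'] at hp'
        have hw'' := hinv' _ hq
        rw [hv'] at hw''
        exact ⟨v', hp', inner_mfderiv_base_map hΦ hα hf hfΦ hp' (w := w') hw''⟩)
    rw [hw, ← this]
    rfl
  set F : M ≃ₘ^∞⟮𝓡∂ 2, 𝓡∂ 2⟯ M := ⟨⟨f, f', hff, hff'⟩, hf, hf'⟩ with hF
  have hiso : ∀ (x : M) (u w : TangentAt x),
      g₂.inner (f x) (mfderiv (𝓡∂ 2) (𝓡∂ 2) f x u) (mfderiv (𝓡∂ 2) (𝓡∂ 2) f x w)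
        = g₁.inner x u w := fun x =>
    metric_ext_of_unit _ fun v hv u =>
      inner_mfderiv_base_map hΦ hα hf hfΦ (p := ⟨x, v⟩) hv (hderiv ⟨x, v⟩ hv) u
  refine ⟨F, ⟨hiso, fun x => ?_⟩, hderiv⟩
  obtain ⟨v, hv⟩ := exists_unit_vector g₁ x
  obtain ⟨e, he, he0⟩ := exists_isOrientedOrthonormal o g₁ x v hv
  have hp : (⟨x, v⟩ : TM M) ∈ unitTangent g₁ := hv
  have h1 := hpos ⟨x, v⟩ hp e he he0
  have hT := ((hasMFDerivAt_tangentMap hf ⟨x, v⟩).hasMFDerivWithinAt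
    (s := unitTangent g₁)).congr_of_eventuallyEq (f₁ := Φ)
      (by filter_upwards [self_mem_nhdsWithin] with q hq using hderiv q hq) (hderiv _ hp)
  have h2 := vertical_eq_of_unitTangent ((hΦ _ hp).mdifferentiableWithinAt
    (by simp)).hasMFDerivWithinAt hT hp he.2.2.1
      (show g₁.inner x v (e 1) = 0 by rw [← he0]; exact he.2.2.2)
  -- On unit vectors `Φ` is the tangent map of `f`, so `df (e 1)` is a non-negative multiple of `e'
  -- 1`. Both being unit vectors, the factor is 1 and `df` carries one oriented basis to the other.
  have h3 : IsPositiveVertical o g₂ (tangentMap (𝓡∂ 2) (𝓡∂ 2) f ⟨x, v⟩)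
      (liftVec (tangentMap (𝓡∂ 2) (𝓡∂ 2) f ⟨x, v⟩) 0 (mfderiv (𝓡∂ 2) (𝓡∂ 2) f x (e 1))) := by
    have h4 := mfderiv_tangentMap_vertical hf ⟨x, v⟩ (e 1)
    rw [← h4, ← hderiv _ hp]
    exact h2 ▸ h1
  obtain ⟨e', he', he'0, β, hβ, hβe⟩ := h3
  have h5 : mfderiv (𝓡∂ 2) (𝓡∂ 2) f x (e 1) = β • e' 1 := congrArg Prod.snd hβe
  have h6 : e' 0 = mfderiv (𝓡∂ 2) (𝓡∂ 2) f x (e 0) := by rw [he'0, he0]; rfl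
  have h7 : β = 1 := eq_one_of_inner_smul (g := g₂) (x := f x) hβ he'.2.2.1
    ((congrArg (fun z : Plane => g₂.inner (f x) z z) h5).symm.trans
      ((hiso x (e 1) (e 1)).trans he.2.2.1))
  have h8 : e.map (F.mfderivToContinuousLinearEquiv (by simp) x).toLinearEquiv = e' := by
    refine Module.Basis.eq_of_apply_eq fun i => ?_
    fin_cases i
    · exact h6.symm
    · exact h5.trans (by rw [h7, one_smul]; rfl)
  rw [← he.1, ← Module.Basis.orientation_map, h8]
  exact he'.1
-- Second derivatives of a map in charts
/-- The expression of `f` in the preferred charts at `x` and `f x`. -/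
def chartMap (f : M → M) (x : M) : Plane → Plane := writtenInExtChartAt (𝓡∂ 2) (𝓡∂ 2) x f

/-- The derivative of `f` at `y` in the trivialisations given by the charts at `x` and `f x`. -/
def chartMapDeriv (f : M → M) (x y : M) : Plane →L[ℝ] Plane :=
  ((trivializationAt Plane (fun x : M => TangentSpace (𝓡∂ 2) x) (f x)).continuousLinearMapAt ℝ
    (f y)).comp ((mfderiv (𝓡∂ 2) (𝓡∂ 2) f y).comp
      ((trivializationAt Plane (fun x : M => TangentSpace (𝓡∂ 2) x) x).symmL ℝ y))

/-- The chain rule holds at every `y` near `x`, not only at `x`, so that this expression can be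
differentiated once more. -/
theorem hasFDerivWithinAt_chartMap {f : M → M} (hf : ContMDiff (𝓡∂ 2) (𝓡∂ 2) ∞ f) {x y : M}
    (hy : y ∈ (chartAt HalfPlane x).source) (hfy : f y ∈ (chartAt HalfPlane (f x)).source) :
    HasFDerivWithinAt (chartMap f x) (chartMapDeriv f x y) (range (𝓡∂ 2))
      (extChartAt (𝓡∂ 2) x y) := by
  have hinv : (extChartAt (𝓡∂ 2) x).symm (extChartAt (𝓡∂ 2) x y) = y :=
    (extChartAt (𝓡∂ 2) x).left_inv (by rwa [extChartAt_source])
  have h1 : HasMFDerivAt (𝓡∂ 2) 𝓘(ℝ, Plane) (extChartAt (𝓡∂ 2) (f x)) (f y)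
      ((trivializationAt Plane (fun x : M => TangentSpace (𝓡∂ 2) x) (f x)).continuousLinearMapAt ℝ
        (f y)) := by
    rw [TangentBundle.continuousLinearMapAt_trivializationAt hfy]
    exact (mdifferentiableAt_extChartAt hfy).hasMFDerivAt
  have h2 := (hf.mdifferentiable (by simp) y).hasMFDerivAt
  have h3 : HasMFDerivWithinAt 𝓘(ℝ, Plane) (𝓡∂ 2) (extChartAt (𝓡∂ 2) x).symm (range (𝓡∂ 2))
      (extChartAt (𝓡∂ 2) x y)
      ((trivializationAt Plane (fun x : M => TangentSpace (𝓡∂ 2) x) x).symmL ℝ y) := by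
    rw [TangentBundle.symmL_trivializationAt hy]
    exact (mdifferentiableWithinAt_extChartAt_symm ((extChartAt (𝓡∂ 2) x).map_source
      (by rwa [extChartAt_source]))).hasMFDerivWithinAt
  have h4 := h1.comp y h2
  have key : ∀ y', y' = y → HasMFDerivAt (𝓡∂ 2) 𝓘(ℝ, Plane) (extChartAt (𝓡∂ 2) (f x) ∘ f) y'
      (((trivializationAt Plane (fun x : M => TangentSpace (𝓡∂ 2) x) (f x)).continuousLinearMapAt ℝ
        (f y)).comp (mfderiv (𝓡∂ 2) (𝓡∂ 2) f y) : Plane →L[ℝ] Plane) := by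
    rintro _ rfl
    exact h4
  have h5 := (key _ hinv).comp_hasMFDerivWithinAt _ h3
  exact h5.hasFDerivWithinAt

theorem chartMapDeriv_self (f : M → M) (x : M) (v : Plane) :
    chartMapDeriv f x x v = mfderiv (𝓡∂ 2) (𝓡∂ 2) f x v := by
  have h1 : ∀ w : TangentAt (f x), (trivializationAt Plane (fun x : M => TangentSpace (𝓡∂ 2) x)
      (f x)).continuousLinearMapAt ℝ (f x) w = (w : Plane) := fun w => by
    rw [Trivialization.continuousLinearMapAt_apply, Trivialization.coe_linearMapAt_of_mem]
    · exact trivializationAt_snd_self_mk (f x) w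
    · exact mem_chart_source _ (f x)
  refine (h1 _).trans ?_
  exact congrArg (mfderiv (𝓡∂ 2) (𝓡∂ 2) f x) (symmL_trivializationAt_self x v)

omit [IsManifold (𝓡∂ 2) ∞ M] in
theorem contDiffWithinAt_chartMap {f : M → M} (hf : ContMDiff (𝓡∂ 2) (𝓡∂ 2) ∞ f) (x : M) :
    ContDiffWithinAt ℝ ∞ (chartMap f x) (range (𝓡∂ 2)) (extChartAt (𝓡∂ 2) x x) :=
  (contMDiffAt_iff.1 (hf x)).2

/-- The second derivatives of `f` at `x` in the preferred charts at `x` and `f x`. -/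
def chartMapHessian (f : M → M) (x : M) : Plane →L[ℝ] Plane →L[ℝ] Plane :=
  fderivWithin ℝ (fderivWithin ℝ (chartMap f x) (range (𝓡∂ 2))) (range (𝓡∂ 2))
    (extChartAt (𝓡∂ 2) x x)

-- The half-plane lies in the closure of its interior, so second derivatives commute at boundary
-- points too.
omit [IsManifold (𝓡∂ 2) ∞ M] in
theorem chartMapHessian_symm {f : M → M} (hf : ContMDiff (𝓡∂ 2) (𝓡∂ 2) ∞ f) (x : M)
    (a b : Plane) : chartMapHessian f x a b = chartMapHessian f x b a := by
  have h := (contDiffWithinAt_chartMap hf x).isSymmSndFDerivWithinAt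
    (by rw [minSmoothness_of_isRCLikeNormedField]; exact WithTop.coe_le_coe.2 (le_top : (2 : ℕ∞) ≤ ⊤))
    (𝓡∂ 2).uniqueDiffOn ((𝓡∂ 2).range_subset_closure_interior (mem_range_self _))
    (mem_range_self _)
  exact h a b

omit [IsManifold (𝓡∂ 2) ∞ M] in
theorem hasFDerivWithinAt_fderivWithin_chartMap {f : M → M} (hf : ContMDiff (𝓡∂ 2) (𝓡∂ 2) ∞ f)
    (x : M) : HasFDerivWithinAt (fderivWithin ℝ (chartMap f x) (range (𝓡∂ 2)))
      (chartMapHessian f x) (range (𝓡∂ 2)) (extChartAt (𝓡∂ 2) x x) :=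
  (((contDiffWithinAt_chartMap hf x).fderivWithin_right (m := 1) (𝓡∂ 2).uniqueDiffOn
    (WithTop.coe_le_coe.2 (le_top : (1 + 1 : ℕ∞) ≤ ⊤))
    (mem_range_self _)).differentiableWithinAt (by simp)).hasFDerivWithinAt

theorem eventually_fderivWithin_chartMap {f : M → M} (hf : ContMDiff (𝓡∂ 2) (𝓡∂ 2) ∞ f)
    (x : M) : ∀ᶠ y in 𝓝 x, y ∈ (chartAt HalfPlane x).source ∧
      f y ∈ (chartAt HalfPlane (f x)).source ∧
      fderivWithin ℝ (chartMap f x) (range (𝓡∂ 2)) (extChartAt (𝓡∂ 2) x y) =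
        chartMapDeriv f x y := by
  filter_upwards [(chartAt HalfPlane x).open_source.mem_nhds (mem_chart_source _ x),
    hf.continuous.continuousAt.preimage_mem_nhds
      ((chartAt HalfPlane (f x)).open_source.mem_nhds (mem_chart_source _ (f x)))] with y h1 h2
  exact ⟨h1, h2, (hasFDerivWithinAt_chartMap hf h1 h2).fderivWithin
    ((𝓡∂ 2).uniqueDiffOn _ (mem_range_self _))⟩

theorem fderivWithin_chartMap_self {f : M → M} (hf : ContMDiff (𝓡∂ 2) (𝓡∂ 2) ∞ f) (x : M)
    (v : Plane) : fderivWithin ℝ (chartMap f x) (range (𝓡∂ 2)) (extChartAt (𝓡∂ 2) x x) v =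
      mfderiv (𝓡∂ 2) (𝓡∂ 2) f x v := by
  rw [(eventually_fderivWithin_chartMap hf x).self_of_nhds.2.2, chartMapDeriv_self]

theorem trivializationAt_tangentMap_chartSection {f : M → M} {x y : M}
    (hy : f y ∈ (chartAt HalfPlane (f x)).source) (v : Plane) :
    (trivializationAt Plane (TangentSpace (𝓡∂ 2)) (f x) (tangentMap (𝓡∂ 2) (𝓡∂ 2) f
      (chartSection (𝓡∂ 2) x v (fun _ => 1) y))).2 = chartMapDeriv f x y v := by
  rw [chartSection_eq_smul, one_smul]
  have := Trivialization.coe_linearMapAt_of_mem (R := ℝ)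
    (trivializationAt Plane (fun x : M => TangentSpace (𝓡∂ 2) x) (f x)) (b := f y) hy
  exact (congrFun this _).symm

/-- Along the chart-constant extension of `v` the fibre coordinate of the tangent map is the first
derivative of `chartMap` applied to `v`; its derivative is the second derivative. -/
theorem mfderiv_tangentMap_horizontal {f : M → M} (hf : ContMDiff (𝓡∂ 2) (𝓡∂ 2) ∞ f) (p : TM M)
    (u : TangentAt p.proj) :
    mfderiv (𝓡∂ 2).tangent (𝓡∂ 2).tangent (tangentMap (𝓡∂ 2) (𝓡∂ 2) f) p (liftVec p u 0) =
      liftVec (tangentMap (𝓡∂ 2) (𝓡∂ 2) f p) (mfderiv (𝓡∂ 2) (𝓡∂ 2) f p.proj u)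
        (chartMapHessian f p.proj u p.snd) := by
  obtain ⟨x, v⟩ := p
  change TangentAt x at u
  set s := chartSection (𝓡∂ 2) x (v : Plane) fun _ => 1 with hs
  have hsx : s x = ⟨x, v⟩ := chartSection_self (E := Plane) x v rfl
  have h1 := (hasMFDerivAt_tangentMap hf (s x)).comp x (hasMFDerivAt_chartSection (I := 𝓡∂ 2) x v)
  have h2 : HasMFDerivWithinAt (𝓡∂ 2) 𝓘(ℝ, Plane)
      (fun z => (trivializationAt Plane (TangentSpace (𝓡∂ 2)) (f x)
        (tangentMap (𝓡∂ 2) (𝓡∂ 2) f (s z))).2) univ x ((chartMapHessian f x).flip v) := by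
    have h3 := ((hasFDerivWithinAt_fderivWithin_chartMap hf x).clm_apply
      (hasFDerivWithinAt_const (v : Plane) _ _)).hasMFDerivWithinAt
    have h4 := HasMFDerivWithinAt.comp x h3 ((hasMFDerivAt_extChartAt_self x).hasMFDerivWithinAt
      (s := univ)) fun y _ => mem_range_self _
    have h5 : ∀ᶠ z in 𝓝 x, (trivializationAt Plane (TangentSpace (𝓡∂ 2)) (f x)
        (tangentMap (𝓡∂ 2) (𝓡∂ 2) f (s z))).2 =
          fderivWithin ℝ (chartMap f x) (range (𝓡∂ 2)) (extChartAt (𝓡∂ 2) x z) v := by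
      filter_upwards [eventually_fderivWithin_chartMap hf x] with z hz
      exact (trivializationAt_tangentMap_chartSection hz.2.1 v).trans
        (congrArg (fun A : Plane →L[ℝ] Plane => A v) hz.2.2.symm)
    have h6 := h4.congr_of_eventuallyEq (f₁ := fun z => (trivializationAt Plane
      (TangentSpace (𝓡∂ 2)) (f x) (tangentMap (𝓡∂ 2) (𝓡∂ 2) f (s z))).2)
      (by rw [nhdsWithin_univ]; exact h5) h5.self_of_nhds
    have h7 : ∀ (A B : Plane →L[ℝ] Plane), A = B → HasMFDerivWithinAt (𝓡∂ 2) 𝓘(ℝ, Plane)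
      (fun z => (trivializationAt Plane (TangentSpace (𝓡∂ 2)) (f x)
        (tangentMap (𝓡∂ 2) (𝓡∂ 2) f (s z))).2) univ x A → HasMFDerivWithinAt (𝓡∂ 2) 𝓘(ℝ, Plane)
      (fun z => (trivializationAt Plane (TangentSpace (𝓡∂ 2)) (f x)
        (tangentMap (𝓡∂ 2) (𝓡∂ 2) f (s z))).2) univ x B := by
      rintro _ _ rfl h
      exact h
    refine h7 _ _ ?_ h6
    ext1 w
    change (fderivWithin ℝ (chartMap f x) (range (𝓡∂ 2)) (extChartAt (𝓡∂ 2) x x)) 0 +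
      chartMapHessian f x w v = chartMapHessian f x w v
    rw [map_zero, zero_add]
  have h3 := HasMFDerivWithinAt.tangentBundle_mk (I := 𝓡∂ 2) (J := 𝓡∂ 2)
    (h := fun z => tangentMap (𝓡∂ 2) (𝓡∂ 2) f (s z)) (s := univ) (y := x)
    (h1.continuousAt.continuousWithinAt)
    (A := mfderiv (𝓡∂ 2) (𝓡∂ 2) f x)
    ((hf.mdifferentiable (by simp) x).hasMFDerivAt.hasMFDerivWithinAt) h2
  rw [hasMFDerivWithinAt_univ] at h3
  have h4 := congrArg (fun A => A u) (hasMFDerivAt_unique h1 h3)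
  have key : ∀ q : TM M, q = ⟨x, v⟩ → ∀ h : q.proj = x,
      mfderiv (𝓡∂ 2).tangent (𝓡∂ 2).tangent (tangentMap (𝓡∂ 2) (𝓡∂ 2) f) q
        (liftVec q (u : Plane) (0 : Plane)) =
      liftVec (tangentMap (𝓡∂ 2) (𝓡∂ 2) f q) (mfderiv (𝓡∂ 2) (𝓡∂ 2) f x u : Plane)
        (chartMapHessian f x u v) →
      mfderiv (𝓡∂ 2).tangent (𝓡∂ 2).tangent (tangentMap (𝓡∂ 2) (𝓡∂ 2) f) ⟨x, v⟩
        (liftVec ⟨x, v⟩ u 0) =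
      liftVec (tangentMap (𝓡∂ 2) (𝓡∂ 2) f ⟨x, v⟩) (mfderiv (𝓡∂ 2) (𝓡∂ 2) f x u)
        (chartMapHessian f x u v) := by
    rintro _ rfl _ h
    exact h
  exact key _ hsx rfl h4
-- Local isometries and the Levi-Civita connection
/-- `f` is a local isometry. -/
def PreservesMetric (g₁ g₂ : Metric M) (f : M → M) : Prop :=
  ∀ (x : M) (u w : TangentAt x),
    g₂.inner (f x) (mfderiv (𝓡∂ 2) (𝓡∂ 2) f x u) (mfderiv (𝓡∂ 2) (𝓡∂ 2) f x w)
      = g₁.inner x u w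

/-- A local isometry, in charts. -/
theorem PreservesMetric.eventually_chartMetric {g₁ g₂ : Metric M} {f : M → M}
    (h : PreservesMetric g₁ g₂ f) (hf : ContMDiff (𝓡∂ 2) (𝓡∂ 2) ∞ f) (x : M) (a b : Plane) :
    ∀ᶠ z in 𝓝[range (𝓡∂ 2)] (extChartAt (𝓡∂ 2) x x),
      chartMetric g₂ (f x) (chartMap f x z) (fderivWithin ℝ (chartMap f x) (range (𝓡∂ 2)) z a)
        (fderivWithin ℝ (chartMap f x) (range (𝓡∂ 2)) z b) = chartMetric g₁ x z a b := by
  have hc : Filter.Tendsto (extChartAt (𝓡∂ 2) x).symm (𝓝[range (𝓡∂ 2)] (extChartAt (𝓡∂ 2) x x))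
      (𝓝 x) := by
    have := (continuousAt_extChartAt_symm (I := 𝓡∂ 2) x).continuousWithinAt
      (s := range (𝓡∂ 2))
    rwa [ContinuousWithinAt, extChartAt_to_inv] at this
  filter_upwards [hc.eventually (eventually_fderivWithin_chartMap hf x),
    extChartAt_target_mem_nhdsWithin (I := 𝓡∂ 2) x] with z hz ht
  obtain ⟨h1, h2, h3⟩ := hz
  have hright := (extChartAt (𝓡∂ 2) x).right_inv ht
  rw [hright] at h3
  rw [h3]
  have h4 : chartMap f x z = extChartAt (𝓡∂ 2) (f x) (f ((extChartAt (𝓡∂ 2) x).symm z)) := rfl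
  rw [h4, chartMetric_extChartAt g₂ h2, chartMetric_apply, ← h]
  have h5 : ∀ c : Plane, (trivializationAt Plane (fun x : M => TangentSpace (𝓡∂ 2) x)
      (f x)).symmL ℝ (f ((extChartAt (𝓡∂ 2) x).symm z))
        (chartMapDeriv f x ((extChartAt (𝓡∂ 2) x).symm z) c) =
      mfderiv (𝓡∂ 2) (𝓡∂ 2) f ((extChartAt (𝓡∂ 2) x).symm z)
        ((trivializationAt Plane (fun x : M => TangentSpace (𝓡∂ 2) x) x).symmL ℝ
          ((extChartAt (𝓡∂ 2) x).symm z) c) := fun c =>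
    Trivialization.symmL_continuousLinearMapAt _ h2 _
  rw [h5, h5]

/-- The second derivatives of `f` at `x` as a map of tangent vectors; this depends on the preferred
charts. -/
def hessian (f : M → M) (x : M) (a b : TangentAt x) : TangentAt (f x) :=
  (chartMapHessian f x a b : Plane)

omit [IsManifold (𝓡∂ 2) ∞ M] in
theorem hessian_symm {f : M → M} (hf : ContMDiff (𝓡∂ 2) (𝓡∂ 2) ∞ f) (x : M) (a b : TangentAt x) :
    hessian f x a b = hessian f x b a := chartMapHessian_symm hf x a b

set_option synthInstance.maxHeartbeats 200000 in
/-- The product rule for a bilinear form along a map. -/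
theorem exists_hasFDerivWithinAt_bilinear {E : Type*} [NormedAddCommGroup E] [NormedSpace ℝ E]
    {G : E → E →L[ℝ] E →L[ℝ] ℝ} {G' : E →L[ℝ] E →L[ℝ] E →L[ℝ] ℝ} {F : E → E} {L : E →L[ℝ] E}
    {D : E → E →L[ℝ] E} {D' : E →L[ℝ] E →L[ℝ] E} {s t : Set E} {z : E}
    (hG : HasFDerivWithinAt G G' t (F z)) (hF : HasFDerivWithinAt F L s z) (hst : MapsTo F s t)
    (hD : HasFDerivWithinAt D D' s z) (a b : E) :
    ∃ A : E →L[ℝ] ℝ, HasFDerivWithinAt (fun z => G (F z) (D z a) (D z b)) A s z ∧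
      ∀ u, A u = G' (L u) (D z a) (D z b) + G (F z) (D' u a) (D z b) +
        G (F z) (D z a) (D' u b) := by
  have hGF : HasFDerivWithinAt (fun z => G (F z)) (G'.comp L) s z :=
    HasFDerivWithinAt.comp (𝕜 := ℝ) (F := E) (G := E →L[ℝ] E →L[ℝ] ℝ) (g := G) (f := F) z
      (by exact hG) hF hst
  have h := (hGF.clm_apply (hD.clm_apply (hasFDerivWithinAt_const a _ _))).clm_apply
    (hD.clm_apply (hasFDerivWithinAt_const b _ _))
  refine ⟨_, h, fun u => ?_⟩
  simp
  ring

/-- The derivative of the equation `f^* g₂ = g₁`, in charts. -/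
theorem PreservesMetric.chartMetricDeriv_eq {g₁ g₂ : Metric M} {f : M → M}
    (h : PreservesMetric g₁ g₂ f) (hf : ContMDiff (𝓡∂ 2) (𝓡∂ 2) ∞ f) (x : M)
    (u a b : TangentAt x) :
    chartMetricDeriv g₁ x u a b =
      chartMetricDeriv g₂ (f x) (mfderiv (𝓡∂ 2) (𝓡∂ 2) f x u) (mfderiv (𝓡∂ 2) (𝓡∂ 2) f x a)
          (mfderiv (𝓡∂ 2) (𝓡∂ 2) f x b) +
        g₂.inner (f x) (hessian f x u a) (mfderiv (𝓡∂ 2) (𝓡∂ 2) f x b) +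
        g₂.inner (f x) (mfderiv (𝓡∂ 2) (𝓡∂ 2) f x a) (hessian f x u b) := by
  have hself : chartMap f x (extChartAt (𝓡∂ 2) x x) = extChartAt (𝓡∂ 2) (f x) (f x) := by
    change extChartAt (𝓡∂ 2) (f x) (f ((extChartAt (𝓡∂ 2) x).symm (extChartAt (𝓡∂ 2) x x))) = _
    rw [extChartAt_to_inv]
  have h1 := ((contDiffWithinAt_chartMap hf x).differentiableWithinAt
    (by simp)).hasFDerivWithinAt
  have h2 := hasFDerivWithinAt_chartMetric g₂ (f x)
  rw [← hself] at h2
  obtain ⟨A, hA, hAu⟩ := exists_hasFDerivWithinAt_bilinear h2 h1 (fun y _ => mem_range_self _)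
    (hasFDerivWithinAt_fderivWithin_chartMap hf x) a b
  have h6 := (hasFDerivWithinAt_chartMetric_apply g₁ x a b).congr_of_eventuallyEq
    (h.eventually_chartMetric hf x a b)
    ((h.eventually_chartMetric hf x a b).self_of_nhdsWithin (mem_range_self _))
  have h7 := congrArg (fun A : Plane →L[ℝ] ℝ => A u)
    (((𝓡∂ 2).uniqueDiffOn _ (mem_range_self _)).eq h6 hA)
  refine h7.trans ((hAu u).trans ?_)
  have e : ∀ c : Plane, fderivWithin ℝ (chartMap f x) (range (𝓡∂ 2)) (extChartAt (𝓡∂ 2) x x) c =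
      mfderiv (𝓡∂ 2) (𝓡∂ 2) f x c := fderivWithin_chartMap_self hf x
  rw [hself, chartMetric_extChartAt_self, chartMetric_extChartAt_self]
  rw [show fderivWithin ℝ (chartMap f x) (range (𝓡∂ 2)) (extChartAt (𝓡∂ 2) x x) u = _ from e u,
    show fderivWithin ℝ (chartMap f x) (range (𝓡∂ 2)) (extChartAt (𝓡∂ 2) x x) a = _ from e a,
    show fderivWithin ℝ (chartMap f x) (range (𝓡∂ 2)) (extChartAt (𝓡∂ 2) x x) b = _ from e b]
  rfl

theorem eq_of_inner_eq (g : Metric M) {x : M} {v w : TangentAt x}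
    (h : ∀ c, g.inner x v c = g.inner x w c) : v = w := by
  apply eq_of_inner_sub_self g
  rw [(g.inner x).map_sub, sub_apply, h, sub_self]

theorem liftVec_add_vertical (p : TM M) (a b c : TangentAt p.proj) :
    liftVec p a b + liftVec p 0 (-(c + b)) = liftVec p a (-c) := by
  rw [← liftVec_add, add_zero, neg_add, add_comm (-c), add_neg_cancel_left]

/-- Paired with `df c`, the left side is a Christoffel symbol of the first kind of `g₁`.
Substituting the derivative of `f^* g₂ = g₁` in its three terms, symmetry of the Hessian cancels
everything except the pairing of `hessian f x a b` with `df c`. -/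
theorem PreservesMetric.mfderiv_christoffel {g₁ g₂ : Metric M} {f : M → M}
    (h : PreservesMetric g₁ g₂ f) (hf : ContMDiff (𝓡∂ 2) (𝓡∂ 2) ∞ f) {x : M}
    (hsurj : Function.Surjective (mfderiv (𝓡∂ 2) (𝓡∂ 2) f x)) (b a : TangentAt x) :
    mfderiv (𝓡∂ 2) (𝓡∂ 2) f x (christoffel g₁ x b a) =
      christoffel g₂ (f x) (mfderiv (𝓡∂ 2) (𝓡∂ 2) f x b) (mfderiv (𝓡∂ 2) (𝓡∂ 2) f x a) +
        hessian f x a b := by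
  have key : ∀ c, g₂.inner (f x) (mfderiv (𝓡∂ 2) (𝓡∂ 2) f x (christoffel g₁ x b a)) c =
      g₂.inner (f x) (christoffel g₂ (f x) (mfderiv (𝓡∂ 2) (𝓡∂ 2) f x b)
        (mfderiv (𝓡∂ 2) (𝓡∂ 2) f x a) + hessian f x a b) c := by
    intro c
    obtain ⟨c, rfl⟩ := hsurj c
    rw [h, inner_christoffel]
    refine Eq.trans ?_ (congrArg (fun A => A (mfderiv (𝓡∂ 2) (𝓡∂ 2) f x c))
      ((g₂.inner (f x)).map_add _ _)).symm
    refine Eq.trans ?_ (congrArg (fun r : ℝ => r + g₂.inner (f x) (hessian f x a b)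
      (mfderiv (𝓡∂ 2) (𝓡∂ 2) f x c)) (inner_christoffel g₂ (f x) (mfderiv (𝓡∂ 2) (𝓡∂ 2) f x b)
        (mfderiv (𝓡∂ 2) (𝓡∂ 2) f x a) (mfderiv (𝓡∂ 2) (𝓡∂ 2) f x c))).symm
    rw [h.chartMetricDeriv_eq hf, h.chartMetricDeriv_eq hf, h.chartMetricDeriv_eq hf,
      hessian_symm hf x b a, hessian_symm hf x c a, hessian_symm hf x c b]
    have s1 := g₂.symm (f x) (hessian f x a c) (mfderiv (𝓡∂ 2) (𝓡∂ 2) f x b)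
    have s2 := g₂.symm (f x) (hessian f x b c) (mfderiv (𝓡∂ 2) (𝓡∂ 2) f x a)
    linear_combination -(1/2) * s1
  exact eq_of_inner_eq g₂ key

/-- The Hessian from the coordinate-horizontal part cancels the one in the transformation law of the
Christoffel symbols. -/
theorem mfderiv_tangentMap_horizontalLift {g₁ g₂ : Metric M} {f : M → M}
    (h : PreservesMetric g₁ g₂ f) (hf : ContMDiff (𝓡∂ 2) (𝓡∂ 2) ∞ f) (p : TM M)
    (hsurj : Function.Surjective (mfderiv (𝓡∂ 2) (𝓡∂ 2) f p.proj)) (u : TangentAt p.proj) :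
    mfderiv (𝓡∂ 2).tangent (𝓡∂ 2).tangent (tangentMap (𝓡∂ 2) (𝓡∂ 2) f) p
        (horizontalLift g₁ p u) =
      horizontalLift g₂ (tangentMap (𝓡∂ 2) (𝓡∂ 2) f p) (mfderiv (𝓡∂ 2) (𝓡∂ 2) f p.proj u) := by
  have h1 : horizontalLift g₁ p u =
      liftVec p u 0 + liftVec p 0 (-christoffel g₁ p.proj p.snd u) := by
    rw [horizontalLift_eq, ← liftVec_add, add_zero, zero_add]
  rw [h1, map_add, mfderiv_tangentMap_horizontal hf, mfderiv_tangentMap_vertical hf, map_neg,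
    h.mfderiv_christoffel hf hsurj]
  exact liftVec_add_vertical (tangentMap (𝓡∂ 2) (𝓡∂ 2) f p) _ _ _
-- From an isometry to a biholomorphism
/-- Naturality of the complex span under a map intertwining two lifts. -/
theorem map_baseChange_le {T T' W W' : Type*} [AddCommGroup T] [Module ℝ T] [AddCommGroup T']
    [Module ℝ T'] [AddCommGroup W] [Module ℝ W] [AddCommGroup W'] [Module ℝ W']
    {D : W →ₗ[ℝ] W'} {L : T →ₗ[ℝ] T'} {V : T →ₗ[ℝ] W} {V' : T' →ₗ[ℝ] W'}
    (h : D ∘ₗ V = V' ∘ₗ L) {A : Submodule ℂ (ℂ ⊗[ℝ] T)} {A' : Submodule ℂ (ℂ ⊗[ℝ] T')}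
    (hA : A.map (L.baseChange ℂ) ≤ A') :
    (A.map (V.baseChange ℂ)).map (D.baseChange ℂ) ≤ A'.map (V'.baseChange ℂ) := by
  rw [← Submodule.map_comp, ← LinearMap.baseChange_comp, h, LinearMap.baseChange_comp,
    Submodule.map_comp]
  exact Submodule.map_mono hA

/-- Two derivatives within the unit tangent bundle agree on a complement of the vertical space. -/
theorem horizontal_eq_of_unitTangent {g : Metric M} {p : TM M} (hp : p ∈ unitTangent g)
    {f : TM M → TM M} {A B : TangentTM p →L[ℝ] TangentTM (f p)}
    (hA : HasMFDerivWithinAt (𝓡∂ 2).tangent (𝓡∂ 2).tangent f (unitTangent g) p A)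
    (hB : HasMFDerivWithinAt (𝓡∂ 2).tangent (𝓡∂ 2).tangent f (unitTangent g) p B)
    (u : TangentAt p.proj) : ∃ w, A (liftVec p u w) = B (liftVec p u w) := by
  obtain ⟨σ, hσ, hσx, hσs, hσm⟩ := exists_unit_section g hp
  have hσd := (hσs.mdifferentiableAt (by simp)).hasMFDerivAt
  generalize p.proj = x at hσx hσs hσm hσd
  subst hσx
  set D := mfderiv (𝓡∂ 2) (𝓡∂ 2).tangent σ x with hD
  have h1 : projDeriv (σ x) (D u) = u := by
    have h2 := (hasMFDerivAt_proj_tangentBundle (I := 𝓡∂ 2) (σ x)).comp x hσd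
    have h3 : (fun q : TM M => q.proj) ∘ σ = id := funext hσ
    rw [h3] at h2
    exact congrArg (fun A => A u) (hasMFDerivAt_unique h2 (hasMFDerivAt_id x))
  have h2 : A.comp D = B.comp D :=
    hasMFDerivAt_unique
      ((HasMFDerivWithinAt.comp x (s := σ ⁻¹' unitTangent g) hA hσd.hasMFDerivWithinAt
        subset_rfl).hasMFDerivAt hσm)
      ((HasMFDerivWithinAt.comp x (s := σ ⁻¹' unitTangent g) hB hσd.hasMFDerivWithinAt
        subset_rfl).hasMFDerivAt hσm)
  obtain ⟨w, hw⟩ := exists_eq_liftVec (σ x) (D u)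
  rw [h1] at hw
  refine ⟨w, ?_⟩
  rw [← hw]
  exact congrArg (fun A => A u) h2

theorem diskBundle_mem_nhds {g : Metric M} {p : TM M} (hp : normSq g p < 1) :
    diskBundle g ∈ 𝓝 p :=
  Filter.mem_of_superset ((contMDiff_normSq g).continuous.continuousAt.preimage_mem_nhds
    (Iio_mem_nhds hp)) fun q h => show normSq g q ≤ 1 from le_of_lt h

/-- The unit vector itself is a direction in which derivatives within the disk bundle are
determined. -/
theorem radial_eq_of_diskBundle {g : Metric M} {p : TM M} (hp : p ∈ unitTangent g)
    {f : TM M → TM M} {A B : TangentTM p →L[ℝ] TangentTM (f p)}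
    (hA : HasMFDerivWithinAt (𝓡∂ 2).tangent (𝓡∂ 2).tangent f (diskBundle g) p A)
    (hB : HasMFDerivWithinAt (𝓡∂ 2).tangent (𝓡∂ 2).tangent f (diskBundle g) p B) :
    A (liftVec p 0 p.snd) = B (liftVec p 0 p.snd) := by
  have hw : HasDerivWithinAt (F := Plane) (fun t : ℝ => (p.snd + t • (-p.snd) : TangentAt p.proj))
      (-p.snd : TangentAt p.proj) (Icc 0 1) 0 :=
    (hasDerivAt_line (E := Plane) p.snd (-p.snd) 0).hasDerivWithinAt
  have h0 : p.snd + (0 : ℝ) • (-p.snd) = p.snd := by rw [zero_smul, add_zero]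
  have h := vertical_eq_of_hasMFDerivWithinAt hA hB h0 hw
    (uniqueDiffOn_Icc zero_lt_one 0 (left_mem_Icc.2 zero_le_one)) (line_mem_diskBundle hp)
  have h2 : liftVec p 0 (-p.snd) = -liftVec p 0 p.snd := by
    have := liftVec_smul p (-1) 0 p.snd
    rwa [smul_zero, neg_one_smul, neg_one_smul] at this
  rw [h2, map_neg, map_neg] at h
  exact neg_injective h

/-- Interior points have a neighbourhood in the disk bundle. At the boundary, inward segments, fibre
circles and local unit sections stay in the disk bundle, and their velocities span the tangent
space. -/
theorem eq_of_hasMFDerivWithinAt_diskBundle (o : SurfaceOrientation M) {g : Metric M} {p : TM M}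
    (hp : p ∈ diskBundle g) {f : TM M → TM M} {A B : TangentTM p →L[ℝ] TangentTM (f p)}
    (hA : HasMFDerivWithinAt (𝓡∂ 2).tangent (𝓡∂ 2).tangent f (diskBundle g) p A)
    (hB : HasMFDerivWithinAt (𝓡∂ 2).tangent (𝓡∂ 2).tangent f (diskBundle g) p B) : A = B := by
  rcases lt_or_eq_of_le (show normSq g p ≤ 1 from hp) with h | h
  · exact hasMFDerivAt_unique (hA.hasMFDerivAt (diskBundle_mem_nhds h))
      (hB.hasMFDerivAt (diskBundle_mem_nhds h))
  · have hAS := hA.mono (unitTangent_subset_diskBundle g)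
    have hBS := hB.mono (unitTangent_subset_diskBundle g)
    obtain ⟨e, he, he0⟩ := exists_isOrientedOrthonormal o g p.proj p.snd h
    have hsmul : ∀ (C : TangentTM p →L[ℝ] TangentTM (f p)) (a : ℝ) (w : TangentAt p.proj),
        C (liftVec p 0 (a • w)) = a • C (liftVec p 0 w) := fun C a w => by
      have := liftVec_smul p a 0 w
      rw [smul_zero] at this
      rw [this, map_smul]
    have hadd : ∀ (C : TangentTM p →L[ℝ] TangentTM (f p)) (u w w' : TangentAt p.proj),
        C (liftVec p u (w + w')) = C (liftVec p u w) + C (liftVec p 0 w') := fun C u w w' => by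
      rw [← map_add, ← liftVec_add, add_zero]
    have hvert : ∀ w, A (liftVec p 0 w) = B (liftVec p 0 w) := by
      intro w
      obtain ⟨a, b, c, d, _, hw, _⟩ := he.exists_coeff w w
      rw [hw, hadd, hadd, hsmul, hsmul, hsmul, hsmul, he0, radial_eq_of_diskBundle h hA hB,
        vertical_eq_of_unitTangent hAS hBS h he.2.2.1
          (show g.inner p.proj p.snd (e 1) = 0 by rw [← he0]; exact he.2.2.2)]
    ext1 ξ
    obtain ⟨w, hw⟩ := exists_eq_liftVec p ξ
    obtain ⟨w', hw'⟩ := horizontal_eq_of_unitTangent h hAS hBS (projDeriv p ξ)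
    -- Agreement over a given horizontal direction is known for one vertical component `w'`; the
    -- difference from `w` is vertical, where agreement is complete.
    rw [hw, ← add_sub_cancel w' w, hadd, hadd, hw', hvert]

theorem mfderivWithin_diskBundle_tangentMap (o : SurfaceOrientation M) {g : Metric M} {p : TM M}
    (hp : p ∈ diskBundle g) {f : M → M} (hf : ContMDiff (𝓡∂ 2) (𝓡∂ 2) ∞ f) :
    mfderivWithin (𝓡∂ 2).tangent (𝓡∂ 2).tangent (tangentMap (𝓡∂ 2) (𝓡∂ 2) f) (diskBundle g) p =
      mfderiv (𝓡∂ 2).tangent (𝓡∂ 2).tangent (tangentMap (𝓡∂ 2) (𝓡∂ 2) f) p := by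
  have h := (hasMFDerivAt_tangentMap hf p).hasMFDerivWithinAt (s := diskBundle g)
  exact eq_of_hasMFDerivWithinAt_diskBundle o hp h.mdifferentiableWithinAt.hasMFDerivWithinAt h

theorem PreservesMetric.normSq_tangentMap {g₁ g₂ : Metric M} {f : M → M}
    (h : PreservesMetric g₁ g₂ f) (p : TM M) :
    normSq g₂ (tangentMap (𝓡∂ 2) (𝓡∂ 2) f p) = normSq g₁ p := h p.proj p.snd p.snd

/-- `twist` is built from the metric and the vector `v` alone, and the tangent map carries both
along. -/
theorem PreservesMetric.mfderiv_twist {g₁ g₂ : Metric M} {f : M → M}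
    (h : PreservesMetric g₁ g₂ f) (p : TM M) (u : TangentAt p.proj) :
    mfderiv (𝓡∂ 2) (𝓡∂ 2) f p.proj (twist g₁ p u) =
      twist g₂ (tangentMap (𝓡∂ 2) (𝓡∂ 2) f p) (mfderiv (𝓡∂ 2) (𝓡∂ 2) f p.proj u) := by
  rw [twist_apply, map_add, map_smul, map_smul, ← h.normSq_tangentMap, ← h]
  exact (twist_apply g₂ (tangentMap (𝓡∂ 2) (𝓡∂ 2) f p) _).symm

theorem map_antiholomorphicTangent_le {o : SurfaceOrientation M} {g₁ g₂ : Metric M}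
    {f : M ≃ₘ^∞⟮𝓡∂ 2, 𝓡∂ 2⟯ M} (hf : IsOrientedIsometry o g₁ g₂ f) (x : M) :
    (antiholomorphicTangent o g₁ x).map
      ((mfderiv (𝓡∂ 2) (𝓡∂ 2) f x).toLinearMap.baseChange ℂ) ≤
      antiholomorphicTangent o g₂ (f x) := by
  rw [antiholomorphicTangent, Submodule.map_span, Submodule.span_le]
  rintro _ ⟨_, ⟨e, he, rfl⟩, rfl⟩
  refine Submodule.subset_span
    ⟨e.map (f.mfderivToContinuousLinearEquiv (by simp) x).toLinearEquiv, ⟨?_, ?_, ?_, ?_⟩, ?_⟩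
  · rw [Module.Basis.orientation_map, he.1, hf.2]
  · exact (hf.1 x _ _).trans he.2.1
  · exact (hf.1 x _ _).trans he.2.2.1
  · exact (hf.1 x _ _).trans he.2.2.2
  · rw [map_add]
    rfl

theorem IsOrientedIsometry.isHolomorphicOn {o : SurfaceOrientation M} {g₁ g₂ : Metric M}
    {f : M ≃ₘ^∞⟮𝓡∂ 2, 𝓡∂ 2⟯ M} (hf : IsOrientedIsometry o g₁ g₂ f) :
    IsHolomorphicOn o g₁ g₂ (tangentMap (𝓡∂ 2) (𝓡∂ 2) f) := by
  intro p hp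
  have hiso : PreservesMetric g₁ g₂ f := hf.1
  have hsurj : Function.Surjective (mfderiv (𝓡∂ 2) (𝓡∂ 2) f p.proj) :=
    (f.mfderivToContinuousLinearEquiv (by simp) p.proj).surjective
  rw [mfderivWithin_diskBundle_tangentMap o hp f.contMDiff]
  have hv : (mfderiv (𝓡∂ 2).tangent (𝓡∂ 2).tangent (tangentMap (𝓡∂ 2) (𝓡∂ 2) f) p).toLinearMap ∘ₗ
      verticalLift p = verticalLift (tangentMap (𝓡∂ 2) (𝓡∂ 2) f p) ∘ₗ
        (mfderiv (𝓡∂ 2) (𝓡∂ 2) f p.proj).toLinearMap :=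
    LinearMap.ext fun w => mfderiv_tangentMap_vertical f.contMDiff p w
  have hh : (mfderiv (𝓡∂ 2).tangent (𝓡∂ 2).tangent (tangentMap (𝓡∂ 2) (𝓡∂ 2) f) p).toLinearMap ∘ₗ
      (horizontalLift g₁ p ∘ₗ twist g₁ p) =
        (horizontalLift g₂ (tangentMap (𝓡∂ 2) (𝓡∂ 2) f p) ∘ₗ
          twist g₂ (tangentMap (𝓡∂ 2) (𝓡∂ 2) f p)) ∘ₗ
        (mfderiv (𝓡∂ 2) (𝓡∂ 2) f p.proj).toLinearMap :=
    LinearMap.ext fun u =>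
      (mfderiv_tangentMap_horizontalLift hiso f.contMDiff p hsurj (twist g₁ p u)).trans
        (congrArg (horizontalLift g₂ (tangentMap (𝓡∂ 2) (𝓡∂ 2) f p)) (hiso.mfderiv_twist p u))
  rw [twistorStructure, Submodule.map_sup]
  exact sup_le_sup (map_baseChange_le hv (map_antiholomorphicTangent_le hf p.proj))
    (map_baseChange_le hh (map_antiholomorphicTangent_le hf p.proj))

omit [IsManifold (𝓡∂ 2) ∞ M] in
theorem tangentMap_symm_tangentMap (f : M ≃ₘ^∞⟮𝓡∂ 2, 𝓡∂ 2⟯ M) (p : TM M) :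
    tangentMap (𝓡∂ 2) (𝓡∂ 2) f.symm (tangentMap (𝓡∂ 2) (𝓡∂ 2) f p) = p := by
  rw [← tangentMap_comp_at _ (f.symm.mdifferentiable (by simp) _)
    (f.mdifferentiable (by simp) _)]
  have : f.symm ∘ f = id := funext f.symm_apply_apply
  rw [this, tangentMap_id]
  rfl

theorem IsOrientedIsometry.symm {o : SurfaceOrientation M} {g₁ g₂ : Metric M}
    {f : M ≃ₘ^∞⟮𝓡∂ 2, 𝓡∂ 2⟯ M} (hf : IsOrientedIsometry o g₁ g₂ f) :
    IsOrientedIsometry o g₂ g₁ f.symm := by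
  have hs : ∀ (x : M) (u : TangentAt (f x)), mfderiv (𝓡∂ 2) (𝓡∂ 2) f x
      (mfderiv (𝓡∂ 2) (𝓡∂ 2) f.symm (f x) u : Plane) = (u : Plane) := by
    intro x u
    have h1 := (f.mdifferentiable (by simp) _).hasMFDerivAt.comp (f x)
      (f.symm.mdifferentiable (by simp) (f x)).hasMFDerivAt
    have h2 : f ∘ f.symm = id := funext f.apply_symm_apply
    rw [h2] at h1
    have h3 := congrArg (fun A => A u) (hasMFDerivAt_unique h1 (hasMFDerivAt_id (f x)))
    have key : ∀ x', x' = x → mfderiv (𝓡∂ 2) (𝓡∂ 2) f x'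
      (mfderiv (𝓡∂ 2) (𝓡∂ 2) f.symm (f x) u : Plane) = (u : Plane) → mfderiv (𝓡∂ 2) (𝓡∂ 2) f x
      (mfderiv (𝓡∂ 2) (𝓡∂ 2) f.symm (f x) u : Plane) = (u : Plane) := by
      rintro _ rfl h
      exact h
    exact key _ (f.symm_apply_apply x) h3
  constructor
  · intro y u w
    obtain ⟨x, rfl⟩ := f.surjective y
    have h1 := hf.1 x (mfderiv (𝓡∂ 2) (𝓡∂ 2) f.symm (f x) u : Plane)
      (mfderiv (𝓡∂ 2) (𝓡∂ 2) f.symm (f x) w : Plane)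
    have key : ∀ x', x' = x → g₁.inner x (mfderiv (𝓡∂ 2) (𝓡∂ 2) f.symm (f x) u : Plane)
      (mfderiv (𝓡∂ 2) (𝓡∂ 2) f.symm (f x) w : Plane) =
        g₂.inner (f x) u w → g₁.inner x' (mfderiv (𝓡∂ 2) (𝓡∂ 2) f.symm (f x) u : Plane)
      (mfderiv (𝓡∂ 2) (𝓡∂ 2) f.symm (f x) w : Plane) = g₂.inner (f x) u w := by
      rintro _ rfl h
      exact h
    refine key _ (f.symm_apply_apply x) (h1.symm.trans ?_)
    exact congrArg₂ (fun a b : Plane => g₂.inner (f x) a b) (hs x u) (hs x w)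
  · intro y
    obtain ⟨x, rfl⟩ := f.surjective y
    have h1 := (f.symm.mdifferentiable (by simp) (f x)).hasMFDerivAt.comp x
      (f.mdifferentiable (by simp) x).hasMFDerivAt
    have h2 : f.symm ∘ f = id := funext f.symm_apply_apply
    rw [h2] at h1
    have h3 := hasMFDerivAt_unique h1 (hasMFDerivAt_id x)
    -- `f.symm (f x)` equals `x` only propositionally, so the claim is generalised to any linear
    -- equivalence inverting `df`; an oriented orthonormal basis then returns to itself.
    have key : ∀ x', x' = x → ∀ G : TangentAt (f x) ≃ₗ[ℝ] TangentAt x',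
        (∀ u : TangentAt x, (G (mfderiv (𝓡∂ 2) (𝓡∂ 2) f x u) : Plane) = u) →
        Orientation.map (Fin 2) G (o.orient (f x)) = o.orient x' := by
      rintro z rfl G hG
      obtain ⟨v, hv⟩ := exists_unit_vector g₁ z
      obtain ⟨e, he, _⟩ := exists_isOrientedOrthonormal o g₁ z v hv
      rw [← hf.2, ← he.1, ← Module.Basis.orientation_map, ← Module.Basis.orientation_map]
      congr 1
      exact Module.Basis.eq_of_apply_eq fun i => hG (e i)
    exact key _ (f.symm_apply_apply x) _ fun u => congrArg (fun A => A u) h3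

/-- The tangent map of an orientation preserving isometry is a biholomorphism. -/
theorem IsOrientedIsometry.isBiholomorphism {o : SurfaceOrientation M} {g₁ g₂ : Metric M}
    {f : M ≃ₘ^∞⟮𝓡∂ 2, 𝓡∂ 2⟯ M} (hf : IsOrientedIsometry o g₁ g₂ f) :
    IsBiholomorphism o g₁ g₂ (tangentMap (𝓡∂ 2) (𝓡∂ 2) f) := by
  refine ⟨tangentMap (𝓡∂ 2) (𝓡∂ 2) f.symm, ⟨?_, ?_, ⟨?_, ?_⟩, ?_, ?_⟩, hf.isHolomorphicOn,
    hf.symm.isHolomorphicOn⟩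
  · intro p hp
    exact (PreservesMetric.normSq_tangentMap hf.1 p).trans_le hp
  · intro p hp
    exact (PreservesMetric.normSq_tangentMap hf.symm.1 p).trans_le hp
  · exact fun p _ => tangentMap_symm_tangentMap f p
  · exact fun p _ => tangentMap_symm_tangentMap f.symm p
  · exact (contMDiff_tangentMap_infty f.contMDiff).contMDiffOn
  · exact (contMDiff_tangentMap_infty f.symm.contMDiff).contMDiffOn

end TransportTwistor

end

/-! ### The equivalence -/

theorem mainTheorem5 {M : Type*} [TopologicalSpace M] [T2Space M] [SecondCountableTopology M]
    [ConnectedSpace M] [ChartedSpace (EuclideanHalfSpace 2) M] [IsManifold (𝓡∂ 2) ∞ M]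
    (o : TransportTwistor.SurfaceOrientation M) (g₁ g₂ : TransportTwistor.Metric M)
    (φ : TransportTwistor.TM M → TransportTwistor.TM M)
    (hφ : TransportTwistor.IsDiffeoOn φ (TransportTwistor.unitTangent g₁)
      (TransportTwistor.unitTangent g₂))
    (hα : TransportTwistor.PullsBackContactForm g₁ g₂ φ) :
    (∃ Φ : TransportTwistor.TM M → TransportTwistor.TM M,
      TransportTwistor.IsBiholomorphism o g₁ g₂ Φ ∧
        Set.EqOn Φ φ (TransportTwistor.unitTangent g₁)) ↔
    ∃ f : M ≃ₘ^∞⟮𝓡∂ 2, 𝓡∂ 2⟯ M, TransportTwistor.IsOrientedIsometry o g₁ g₂ f ∧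
      Set.EqOn φ (tangentMap (𝓡∂ 2) (𝓡∂ 2) f) (TransportTwistor.unitTangent g₁) := by
  constructor
  · rintro ⟨Φ, ⟨Ψ, hpair, hhol, _⟩, hΦφ⟩
    obtain ⟨ψ, hψ⟩ := hφ
    have hm : Set.MapsTo Φ (TransportTwistor.unitTangent g₁) (TransportTwistor.unitTangent g₂) :=
      hψ.mapsTo.congr hΦφ.symm
    have hm' : Set.MapsTo Ψ (TransportTwistor.unitTangent g₂)
        (TransportTwistor.unitTangent g₁) := by
      intro q hq
      -- That `Ψ` preserves unit vectors is not part of being a biholomorphism. It holds because `Φ`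
      -- already maps the unit vector `ψ q` to `q`, so `Ψ q = ψ q`.
      have h1 := hψ.mapsTo_inv hq
      have h2 : Φ (ψ q) = q := (hΦφ h1).trans (hψ.invOn.2 hq)
      have h3 : Ψ q = ψ q := by
        rw [← hpair.invOn.1 (TransportTwistor.unitTangent_subset_diskBundle g₁ h1), h2]
      rw [h3]
      exact h1
    obtain ⟨f, hf, hfΦ⟩ := TransportTwistor.exists_isometry_of_biholomorphism hpair hhol hm hm'
      (hα.congr hΦφ)
    exact ⟨f, hf, fun p hp => (hΦφ hp).symm.trans (hfΦ hp)⟩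
  · rintro ⟨f, hf, hφf⟩
    exact ⟨_, hf.isBiholomorphism, hφf.symm⟩
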